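/- Let $d\in\{2,3\}$ and let $\Omega\subset\mathbb R^d$ be a polygonal/polyhedral domain: a connected open set with $\Omega=\operatorname{int}\overline\Omega$ whose closure is triangulated by a finite conforming simplicial mesh $\mathcal T_h$ of $d$-simplices $K$. Let $h=\max_K\operatorname{diam}K$, let $\mathcal F_{int}$ be the set of interior faces, $h_F=\operatorname{diam}F$, and let $n$ be the outer unit normal on $\partial\Omega$. Let $X_h^1$ be the space of continuous functions on $\overline\Omega$ that are affine on every $K$, let $V_h\subseteq X_h^1$ be any linear subspace, and let $a_h:V_h\times V_h\to\mathbb R$ be any bilinear form. Let $\mu>0$, and $\gamma_{1,F}>0$, $\gamma_{2,F}\ge 0$ for $F\in\mathcal F_{int}$, and put $$s_{cip}(u,v)=\sum_{F\in\mathcal F_{int}}\int_F\Big(h_F\gamma_{1,F}\,[\![\nabla u]\!]\cdot[\![\nabla v]\!]+h_F^3\gamma_{2,F}\,[\![\Delta u]\!]\,[\![\Delta v]\!]\Big)\,ds ,$$ where $[\![\cdot]\!]$ is the jump across $F$ of the elementwise quantity. For $y\in\{p,a\}$ (primal, adjoint) let $\Gamma_D^y,\Gamma_N^y\subseteq\partial\Omega$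 be measurable, possibly empty, let $\gamma_D^y,\gamma_N^y>0$, and put $$s_y(u,v)=s_{cip}(u,v)+\int_{\Gamma_D^y}\gamma_D^y\,\mu\,h^{-1}uv\,ds+\int_{\Gamma_N^y}\gamma_N^y\,h\,(\nabla u\cdot n)(\nabla v\cdot n)\,ds .$$ Given linear functionals $\ell_1,\ell_2$ on $V_h$, consider the system (FEM): find $(u_h,z_h)\in V_h\times V_h$ such that $$a_h(u_h,w_h)+s_a(z_h,w_h)=\ell_1(w_h),\qquad a_h(v_h,z_h)-s_p(u_h,v_h)=\ell_2(v_h)\qquad\text{for all }v_h,w_h\in V_h$$ (for example $\ell_1=(f,\cdot)$, $\ell_2=-s_p(u,\cdot)$ with $u$ the exact solution). A side of $\Omega$ is a flat part of $\partial\Omega$, contained in a hyperplane and with nonempty interior relative to that hyperplane. It is called a Dirichlet side for $y$ if it is contained in $\Gamma_D^y$ (weak imposition) or if all functions of $V_h$ vanish on it (strong imposition), and a penalised Neumann side for $y$ if it is contained in $\Gamma_N^y$. Then the solutions of the homogeneous system ($\ell_1=\ell_2=0$) form a linear space of dimension at most $2(d+1)$. Moreover, (FEM) has exactly one solution for all $\ell_1,\ell_2$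 if one of the following holds: 1. for each $y\in\{p,a\}$ there are two non-parallel Dirichlet sides; 2. for each $y\in\{p,a\}$ there are a Dirichlet side and a penalised Neumann side that are not orthogonal to each other; 3. for each $y\in\{p,a\}$ there are $d$ penalised Neumann sides whose normals are linearly independent, and in addition either $1\notin V_h$, or there are $v_h,w_h\in V_h$ with $a_h(1,v_h)\ne0$ and $a_h(w_h,1)\ne0$. -/

import Mathlib

open scoped MeasureTheory InnerProductSpace

noncomputable section

namespace CIP

variable {d : ℕ}

/-- The Euclidean space `ℝ^d`. -/
abbrev E (d : ℕ) : Type := EuclideanSpace ℝ (Fin d)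

/-- `Ω` is the interior of its closure, open and connected: together with the existence of a
triangulation (below) this says that `Ω` is a polygonal / polyhedral domain. -/
structure IsDomainSet (Ω : Set (E d)) : Prop where
  connected : IsConnected Ω
  regular : interior (closure Ω) = Ω

/-- A (conforming) triangulation of the closure of `Ω`: a finite simplicial complex, all of whose
maximal simplices are `d`-dimensional, and whose underlying set is the closure of `Ω`.
Simplices are represented by their vertex sets. -/
structure Triangulation (Ω : Set (E d)) extends Geometry.SimplicialComplex ℝ (E d) where
  finite_faces : faces.Finite
  pure : ∀ s ∈ faces, ∃ t ∈ faces, s ⊆ t ∧ t.card = d + 1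
  space_eq : toSimplicialComplex.space = closure Ω

/-- The geometric simplex with the given vertices. -/
def hull (s : Finset (E d)) : Set (E d) := convexHull ℝ (s : Set (E d))

namespace Triangulation

variable {Ω : Set (E d)} (T : Triangulation Ω)

/-- The elements `K` of the mesh: the `d`-simplices. -/
def cells : Finset (Finset (E d)) := T.finite_faces.toFinset.filter fun s => s.card = d + 1

/-- The `(d-1)`-dimensional faces of the mesh. -/
def facets : Finset (Finset (E d)) := T.finite_faces.toFinset.filter fun s => s.card = d

open Classical in
/-- The elements that have `F` as a face. -/
def cellsAt (F : Finset (E d)) : Finset (Finset (E d)) := T.cells.filter fun K => F ⊆ K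

/-- Interior faces: those shared by two elements. -/
def interiorFacets : Finset (Finset (E d)) := T.facets.filter fun F => (T.cellsAt F).card = 2

/-- Boundary faces: those belonging to a single element. -/
def boundaryFacets : Finset (Finset (E d)) := T.facets.filter fun F => (T.cellsAt F).card = 1

/-- The mesh size `h = max_K diam K`. -/
def meshSize : ℝ := ⨆ K : T.cells, Metric.diam (hull K.1)

/-- The space `X_h^1` of functions that are continuous on the closure of `Ω` and affine on every
element. Functions on the closure of `Ω` are represented by their extension by zero. -/
def P1 : Submodule ℝ (E d → ℝ) where
  carrier := {v | ContinuousOn v (closure Ω) ∧ (∀ x ∉ closure Ω, v x = 0) ∧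
    ∀ K ∈ T.cells, ∃ p : E d →ᵃ[ℝ] ℝ, Set.EqOn v p (hull K)}
  add_mem' := by
    rintro u v ⟨hu, hu0, hup⟩ ⟨hv, hv0, hvp⟩
    refine ⟨hu.add hv, fun x hx => by simp [hu0 x hx, hv0 x hx], fun K hK => ?_⟩
    obtain ⟨p, hp⟩ := hup K hK
    obtain ⟨q, hq⟩ := hvp K hK
    exact ⟨p + q, fun x hx => by simp [hp hx, hq hx]⟩
  zero_mem' := ⟨continuousOn_const, fun _ _ => rfl, fun _ _ => ⟨0, fun _ _ => rfl⟩⟩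
  smul_mem' := by
    rintro c v ⟨hv, hv0, hvp⟩
    refine ⟨hv.const_smul c, fun x hx => by simp [hv0 x hx], fun K hK => ?_⟩
    obtain ⟨p, hp⟩ := hvp K hK
    exact ⟨c • p, fun x hx => by simp [hp hx]⟩

end Triangulation

/-- The constant function `1` on the closure of `Ω` (extended by zero). -/
def one (Ω : Set (E d)) : E d → ℝ := (closure Ω).indicator fun _ => 1

/-- The gradient of `v|_K` at a point of `K` (one-sided at the boundary of `K`). -/
def grad (K : Finset (E d)) (v : E d → ℝ) (x : E d) : E d := gradientWithin v (hull K) x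

/-- The Laplacian of `v|_K` at a point of `K`. -/
def lap (K : Finset (E d)) (v : E d → ℝ) (x : E d) : ℝ :=
  InnerProductSpace.laplacianWithin v (hull K) x

/-- `ν` is the unit normal to the face `F` of `K` pointing out of `K`. -/
def IsOuterNormal (K F : Finset (E d)) (ν : E d) : Prop :=
  ‖ν‖ = 1 ∧ (∀ x ∈ F, ∀ y ∈ F, ⟪ν, y - x⟫_ℝ = 0) ∧ ∀ x ∈ F, ∀ y ∈ K, ⟪ν, y - x⟫_ℝ ≤ 0

/-- The outer unit normal to the face `F` of `K`. -/
def outerNormal (K F : Finset (E d)) : E d := Classical.epsilon (IsOuterNormal K F)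

/-- The continuous interior penalty form
`∑_{F interior} ∫_F (h_F γ₁ ⟦∇u⟧ · ⟦∇v⟧ + h_F³ γ₂ ⟦Δu⟧ ⟦Δv⟧)`.
Each interior face is shared by exactly two elements `K, K'`; the ordered pairs `(K, K')` and
`(K', K)` give the same contribution, whence the factor `1 / 2`. -/
def scip {Ω : Set (E d)} (T : Triangulation Ω) (γ₁ γ₂ : Finset (E d) → ℝ) (u v : E d → ℝ) : ℝ :=
  ∑ F ∈ T.interiorFacets, (1 / 2 : ℝ) * ∑ p ∈ (T.cellsAt F).offDiag,
    ∫ x in hull F,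
      (Metric.diam (hull F) * γ₁ F *
          ⟪grad p.1 u x - grad p.2 u x, grad p.1 v x - grad p.2 v x⟫_ℝ +
        Metric.diam (hull F) ^ 3 * γ₂ F *
          ((lap p.1 u x - lap p.2 u x) * (lap p.1 v x - lap p.2 v x))) ∂μHE[d - 1]

/-- The data of the weakly imposed boundary conditions: the Dirichlet part `ΓD` and the Neumann
part `ΓN` of the boundary, with the corresponding penalty parameters. Both parts may be empty. -/
structure WeakBC (Ω : Set (E d)) where
  ΓD : Set (E d)
  ΓN : Set (E d)
  γD : ℝ
  γN : ℝ
  ΓD_subset : ΓD ⊆ frontier Ω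
  ΓN_subset : ΓN ⊆ frontier Ω
  measurableSet_ΓD : MeasurableSet ΓD
  measurableSet_ΓN : MeasurableSet ΓN
  γD_pos : 0 < γD
  γN_pos : 0 < γN

/-- The Dirichlet penalty `∫_{ΓD} γD μ h⁻¹ u v ds`. -/
def dirichletPenalty {Ω : Set (E d)} (T : Triangulation Ω) (μ : ℝ) (B : WeakBC Ω)
    (u v : E d → ℝ) : ℝ :=
  ∫ x in B.ΓD, B.γD * μ * (T.meshSize)⁻¹ * (u x * v x) ∂μHE[d - 1]

/-- The Neumann penalty `∫_{ΓN} γN h (∇u · n) (∇v · n) ds`, split over the boundary faces; the sum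
over `T.cellsAt F` has a single term, the element adjacent to `F`. -/
def neumannPenalty {Ω : Set (E d)} (T : Triangulation Ω) (B : WeakBC Ω) (u v : E d → ℝ) : ℝ :=
  ∑ F ∈ T.boundaryFacets, ∑ K ∈ T.cellsAt F, ∫ x in hull F ∩ B.ΓN,
    B.γN * T.meshSize *
      (⟪grad K u x, outerNormal K F⟫_ℝ * ⟪grad K v x, outerNormal K F⟫_ℝ) ∂μHE[d - 1]

/-- The stabilisation operator with boundary conditions `B`. -/
def stab {Ω : Set (E d)} (T : Triangulation Ω) (γ₁ γ₂ : Finset (E d) → ℝ) (μ : ℝ) (B : WeakBC Ω)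
    (u v : E d → ℝ) : ℝ :=
  scip T γ₁ γ₂ u v + dirichletPenalty T μ B u v + neumannPenalty T B u v

/-- `(u, z)` solves the discrete system with right-hand sides `ℓ₁, ℓ₂`:
`a_h(u, w) + s_a(z, w) = ℓ₁(w)` for all `w` and `a_h(v, z) - s_p(u, v) = ℓ₂(v)` for all `v`. -/
def SolvesFEM {V : Submodule ℝ (E d → ℝ)} (ah : V →ₗ[ℝ] V →ₗ[ℝ] ℝ)
    (sp sa : (E d → ℝ) → (E d → ℝ) → ℝ) (ℓ₁ ℓ₂ : V →ₗ[ℝ] ℝ) (p : V × V) : Prop :=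
  (∀ w : V, ah p.1 w + sa p.2 w = ℓ₁ w) ∧ ∀ v : V, ah v p.2 - sp p.1 v = ℓ₂ v

/-- `S` is a side of `Ω` with unit normal `ν`: a flat part of the boundary, contained in a
hyperplane orthogonal to `ν` and with nonempty interior relative to that hyperplane. (Maximality is
not required, so a nondegenerate part of a side is also admitted.) -/
def IsSide (Ω S : Set (E d)) (ν : E d) : Prop :=
  S ⊆ frontier Ω ∧ ‖ν‖ = 1 ∧ ∃ c : ℝ, (∀ x ∈ S, ⟪ν, x⟫_ℝ = c) ∧
    ∃ x ∈ S, ∃ r > 0, ∀ y ∈ Metric.ball x r, ⟪ν, y⟫_ℝ = c → y ∈ S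

/-- There is a side with unit normal `ν` subject to a Dirichlet condition, either weakly through
the penalty term or strongly, all functions of the discrete space vanishing there. -/
def HasDirichletSide {Ω : Set (E d)} (V : Submodule ℝ (E d → ℝ)) (B : WeakBC Ω) (ν : E d) : Prop :=
  ∃ S, IsSide Ω S ν ∧ (S ⊆ B.ΓD ∨ ∀ v ∈ V, ∀ x ∈ S, v x = 0)

/-- There is a side with unit normal `ν` subject to a Neumann condition imposed by penalty. -/
def HasNeumannSide {Ω : Set (E d)} (B : WeakBC Ω) (ν : E d) : Prop :=
  ∃ S, IsSide Ω S ν ∧ S ⊆ B.ΓN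

/-- Two non-parallel Dirichlet sides. -/
def TwoDirichletSides {Ω : Set (E d)} (V : Submodule ℝ (E d → ℝ)) (B : WeakBC Ω) : Prop :=
  ∃ ν₁ ν₂ : E d, HasDirichletSide V B ν₁ ∧ HasDirichletSide V B ν₂ ∧
    LinearIndependent ℝ ![ν₁, ν₂]

/-- A Dirichlet side and a Neumann side that are not orthogonal. -/
def DirichletNeumannSides {Ω : Set (E d)} (V : Submodule ℝ (E d → ℝ)) (B : WeakBC Ω) : Prop :=
  ∃ ν₁ ν₂ : E d, HasDirichletSide V B ν₁ ∧ HasNeumannSide B ν₂ ∧ ⟪ν₁, ν₂⟫_ℝ ≠ 0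

/-- `d` Neumann sides with linearly independent normals. -/
def IndependentNeumannSides {Ω : Set (E d)} (B : WeakBC Ω) : Prop :=
  ∃ ν : Fin d → E d, (∀ i, HasNeumannSide B (ν i)) ∧ LinearIndependent ℝ ν

/-- Either `1 ∉ V`, or `a_h(1, v) ≠ 0` and `a_h(w, 1) ≠ 0` for some `v, w ∈ V`. -/
def ConstantsCondition (Ω : Set (E d)) {V : Submodule ℝ (E d → ℝ)}
    (ah : V →ₗ[ℝ] V →ₗ[ℝ] ℝ) : Prop :=
  one Ω ∉ V ∨ ∃ h1 : one Ω ∈ V, ∃ v w : V, ah ⟨one Ω, h1⟩ v ≠ 0 ∧ ah w ⟨one Ω, h1⟩ ≠ 0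

end CIP

end

/-! Testing the homogeneous system with `w = z` and `v = u` and subtracting cancels `a_h(u, z)` and
leaves `s_p(u, u) + s_a(z, z) = 0`. Both forms are positive semidefinite, so both terms vanish,
whatever `a_h` is (`self_eq_zero_of_saddle_eq_zero`). Everything then rests on the kernel of a
stabilisation.

If `s_cip(u, u) = 0`, the gradient of `u` does not jump across interior faces. With continuity, `u`
is locally affine at every point of `Ω` off the faces of codimension at least two. A finite union of
such flats cannot separate the connected open set `Ω`, so `u` is one affine function
(`exists_affineMap_of_scip_self_eq_zero`). Affine functions are determined by their values at the `d
+ 1` vertices of one cell, whence the bound `2 (d + 1)`.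

A Dirichlet side makes the affine function vanish on a piece of a hyperplane, so its gradient is a
multiple of the normal; a penalised Neumann side makes the gradient orthogonal to the normal.
Conditions 1 and 2 force a zero gradient and a zero value, hence `u = z = 0`. Condition 3 leaves
only constants; by Cauchy–Schwarz the stabilisation terms then drop out of the equations, and
`a_h(1, v) ≠ 0`, `a_h(w, 1) ≠ 0` eliminate the constants unless `1 ∉ V_h` already does. Finally, the
system is a linear map from `V × V` to `V* × V*`, spaces of equal finite dimension, so injectivity
gives bijectivity. -/

noncomputable section

namespace CIP

open Module Set Filter Topology MeasureTheory

/-! ### Affine subspaces: dimension and measure -/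

section AffineSubspaces

variable {V : Type*} [NormedAddCommGroup V] [InnerProductSpace ℝ V]

theorem isometry_coe_add (W : Submodule ℝ V) (x : V) : Isometry fun v : W => (v : V) + x :=
  (isometry_add_right x).comp W.subtypeₗᵢ.isometry

theorem image_coe_add_univ {A : AffineSubspace ℝ V} {x : V} (hx : x ∈ A) :
    (fun v : A.direction => (v : V) + x) '' univ = A := by
  ext y
  constructor
  · rintro ⟨v, -, rfl⟩
    exact AffineSubspace.vadd_mem_of_mem_direction v.2 hx
  · intro hy
    exact ⟨⟨y - x, AffineSubspace.vsub_mem_direction hy hx⟩, mem_univ _, by simp⟩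

theorem image_coe_add_ball {A : AffineSubspace ℝ V} {x : V} (hx : x ∈ A) (r : ℝ) :
    (fun v : A.direction => (v : V) + x) '' Metric.ball 0 r = (A : Set V) ∩ Metric.ball x r := by
  ext y
  constructor
  · rintro ⟨v, hv, rfl⟩
    refine ⟨AffineSubspace.vadd_mem_of_mem_direction v.2 hx, ?_⟩
    simpa using hv
  · rintro ⟨hy, hr⟩
    refine ⟨⟨y - x, AffineSubspace.vsub_mem_direction hy hx⟩, ?_, by simp⟩
    simpa [dist_eq_norm] using hr

variable [FiniteDimensional ℝ V]

theorem dimH_affineSubspace_le (A : AffineSubspace ℝ V) :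
    dimH (A : Set V) ≤ finrank ℝ A.direction := by
  rcases (A : Set V).eq_empty_or_nonempty with h | ⟨x, hx⟩
  · simp [h]
  · rw [← image_coe_add_univ hx, (isometry_coe_add _ x).dimH_image, Real.dimH_univ_eq_finrank]

variable [MeasurableSpace V] [BorelSpace V]

theorem euclideanHausdorffMeasure_eq_zero_of_dimH_lt {X : Type*} [EMetricSpace X]
    [MeasurableSpace X] [BorelSpace X] {s : Set X} {k : ℕ} (h : dimH s < k) :
    μHE[k] s = 0 := by
  have : (μH[((k : NNReal) : ℝ)] : Measure X) s = 0 := hausdorffMeasure_of_dimH_lt (by simpa using h)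
  rw [Measure.euclideanHausdorffMeasure_def, Measure.smul_apply]
  simp only [NNReal.coe_natCast] at this
  rw [this, smul_zero]

theorem euclideanHausdorffMeasure_affineSubspace_eq_zero (A : AffineSubspace ℝ V) {k : ℕ}
    (h : finrank ℝ A.direction < k) : μHE[k] (A : Set V) = 0 :=
  euclideanHausdorffMeasure_eq_zero_of_dimH_lt
    ((dimH_affineSubspace_le A).trans_lt (by exact_mod_cast h))

/-- Translation is an isometry from the direction space onto the flat, and in the matching dimension
the normalised Hausdorff measure is Lebesgue measure. Positivity and finiteness of face measures
both come from here. -/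
theorem euclideanHausdorffMeasure_inter_ball {A : AffineSubspace ℝ V} {x : V} (hx : x ∈ A) (r : ℝ)
    {k : ℕ} (hk : finrank ℝ A.direction = k) :
    μHE[k] ((A : Set V) ∩ Metric.ball x r) = volume (Metric.ball (0 : A.direction) r) := by
  rw [← image_coe_add_ball hx, (isometry_coe_add _ x).euclideanHausdorffMeasure_image, ← hk,
    InnerProductSpace.euclideanHausdorffMeasure_eq_volume]

theorem euclideanHausdorffMeasure_inter_ball_pos {A : AffineSubspace ℝ V} {x : V} (hx : x ∈ A)
    {r : ℝ} (hr : 0 < r) {k : ℕ} (hk : finrank ℝ A.direction = k) :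
    0 < μHE[k] ((A : Set V) ∩ Metric.ball x r) := by
  rw [euclideanHausdorffMeasure_inter_ball hx r hk]
  exact Metric.measure_ball_pos _ _ hr

theorem euclideanHausdorffMeasure_lt_top_of_isBounded {A : AffineSubspace ℝ V} {s : Set V}
    (hs : s ⊆ A) (hb : Bornology.IsBounded s) {k : ℕ} (hk : finrank ℝ A.direction = k) :
    μHE[k] s < ⊤ := by
  rcases s.eq_empty_or_nonempty with h | ⟨x, hx⟩
  · simp [h]
  obtain ⟨r, hr⟩ := hb.subset_ball x
  refine (measure_mono (subset_inter hs hr)).trans_lt ?_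
  rw [euclideanHausdorffMeasure_inter_ball (hs hx) r hk]
  exact measure_ball_lt_top

end AffineSubspaces

/-! ### Functions that are locally affine off a set of codimension two -/

section LocallyAffine

variable {V : Type*} [NormedAddCommGroup V] [InnerProductSpace ℝ V]

theorem affineMap_eq_of_eventuallyEq {p q : V →ᵃ[ℝ] ℝ} {x : V} (h : p =ᶠ[𝓝 x] q) : p = q := by
  have hs : {y | p y = q y} ∈ 𝓝 x := h
  have hspan : affineSpan ℝ (interior {y | p y = q y}) = ⊤ :=
    isOpen_interior.affineSpan_eq_top ⟨x, mem_interior_iff_mem_nhds.2 hs⟩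
  exact AffineMap.ext_on hspan fun y hy => interior_subset (s := {y | p y = q y}) hy

/-- Having germ `p` is an open condition. It is also closed in `S`: at a limit point the local
affine function agrees with `p` near some nearby point, and two affine functions that agree on an
open set coincide. -/
theorem eventuallyEq_of_preconnected {u : V → ℝ} {S : Set V} (hS : IsPreconnected S)
    (hloc : ∀ x ∈ S, ∃ p : V →ᵃ[ℝ] ℝ, u =ᶠ[𝓝 x] p) {p : V →ᵃ[ℝ] ℝ} {x : V} (hx : x ∈ S)
    (hp : u =ᶠ[𝓝 x] p) {y : V} (hy : y ∈ S) : u =ᶠ[𝓝 y] p := by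
  have hopen : IsOpen {z | u =ᶠ[𝓝 z] p} := isOpen_setOfPred_eventually_nhds
  refine hS.subset_of_closure_inter_subset hopen ⟨x, hx, hp⟩ ?_ hy
  rintro z ⟨hz, hzS⟩
  obtain ⟨q, hq⟩ := hloc z hzS
  obtain ⟨w, hw, hwp⟩ := mem_closure_iff_nhds.1 hz _ (eventually_eventually_nhds.2 hq)
  have : q = p := affineMap_eq_of_eventuallyEq (EventuallyEq.trans (EventuallyEq.symm hw) hwp)
  exact this ▸ hq

variable [FiniteDimensional ℝ V]

theorem dense_compl_biUnion_affineSubspace {𝒜 : Set (AffineSubspace ℝ V)} (h𝒜 : 𝒜.Finite)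
    (hdim : ∀ A ∈ 𝒜, finrank ℝ A.direction < finrank ℝ V) :
    Dense (⋃ A ∈ 𝒜, (A : Set V))ᶜ := by
  rcases 𝒜.eq_empty_or_nonempty with rfl | hne
  · simp
  apply dense_compl_of_dimH_lt_finrank
  rw [dimH_bUnion h𝒜.countable]
  -- The supremum must be attained for the strict inequality to survive, so a flat of maximal
  -- dimension is selected.
  obtain ⟨A, hA, hmax⟩ := h𝒜.exists_maximalFor (fun A : AffineSubspace ℝ V => dimH (A : Set V)) 𝒜 hne
  refine (iSup₂_le (a := dimH (A : Set V)) fun B hB => ?_).trans_lt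
    ((dimH_affineSubspace_le A).trans_lt (by exact_mod_cast hdim A hA))
  rcases le_total (dimH (A : Set V)) (dimH (B : Set V)) with h | h
  · exact hmax hB h
  · exact h

/-- Flats of codimension two do not separate a ball: seen from a point `x`, they block only the
points in the flats spanned by `x` and some `A`, which have codimension at least one. Along every
other segment from `x` the germ is preserved, and continuity fills in the blocked points. -/
theorem exists_affineMap_eqOn_of_locally_affine {Ω : Set V} (hΩo : IsOpen Ω) (hΩc : IsConnected Ω)
    {u : V → ℝ} (hu : ContinuousOn u Ω) {𝒜 : Set (AffineSubspace ℝ V)} (h𝒜 : 𝒜.Finite)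
    (hdim : ∀ A ∈ 𝒜, finrank ℝ A.direction + 2 ≤ finrank ℝ V)
    (hloc : ∀ x ∈ Ω, (∀ A ∈ 𝒜, x ∉ A) → ∃ p : V →ᵃ[ℝ] ℝ, u =ᶠ[𝓝 x] p) :
    ∃ p : V →ᵃ[ℝ] ℝ, EqOn u p Ω := by
  obtain ⟨x₀, hx₀Ω, hx₀⟩ := (dense_compl_biUnion_affineSubspace h𝒜
    fun A hA => by have := hdim A hA; omega).inter_open_nonempty Ω hΩo hΩc.nonempty
  obtain ⟨p, hp⟩ := hloc x₀ hx₀Ω (by simpa using hx₀)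
  refine ⟨p, fun y hy => ?_⟩
  have hopen : IsOpen {z | u =ᶠ[𝓝 z] p} := isOpen_setOfPred_eventually_nhds
  suffices H : closure {z | u =ᶠ[𝓝 z] p} ∩ Ω ⊆ {z | u =ᶠ[𝓝 z] p} from
    (hΩc.isPreconnected.subset_of_closure_inter_subset hopen ⟨x₀, hx₀Ω, hp⟩ H hy).self_of_nhds
  rintro y ⟨hyc, hyΩ⟩
  obtain ⟨r, hr, hball⟩ := Metric.isOpen_iff.1 hΩo y hyΩ
  obtain ⟨x, hxB, hx⟩ := mem_closure_iff_nhds.1 hyc _ (Metric.ball_mem_nhds y hr)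
  have hdense : Dense (⋃ B ∈ (fun A : AffineSubspace ℝ V => affineSpan ℝ (insert x (A : Set V))) '' 𝒜,
      (B : Set V))ᶜ := by
    refine dense_compl_biUnion_affineSubspace (h𝒜.image _) ?_
    rintro _ ⟨A, hA, rfl⟩
    rw [direction_affineSpan]
    have := finrank_vectorSpan_insert_le A x
    have := hdim A hA
    omega
  have key : ∀ z ∈ Metric.ball y r, z ∈ (⋃ B ∈ (fun A : AffineSubspace ℝ V =>
      affineSpan ℝ (insert x (A : Set V))) '' 𝒜, (B : Set V))ᶜ → u z = p z := by
    intro z hzB hz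
    simp only [mem_compl_iff, mem_iUnion, mem_image, SetLike.mem_coe, not_exists] at hz
    refine (eventuallyEq_of_preconnected (convex_segment x z).isPreconnected (fun w hw => ?_)
      (left_mem_segment ℝ x z) hx (right_mem_segment ℝ x z)).self_of_nhds
    by_cases hwx : w = x
    -- The point `x` may itself lie on a flat of `𝒜`, but its germ is known.
    · exact ⟨p, hwx ▸ hx⟩
    refine hloc w (hball ((convex_ball y r).segment_subset hxB hzB hw)) fun A hA hwA => ?_
    -- The line through `x` and `w ∈ A` lies in the span of `x` and `A` and contains `z`.
    refine hz _ ⟨A, hA, rfl⟩ ?_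
    rw [segment_eq_image_lineMap] at hw
    obtain ⟨t, -, rfl⟩ := hw
    have ht : t ≠ 0 := by
      rintro rfl
      simp at hwx
    have hxs : x ∈ affineSpan ℝ (insert x (A : Set V)) := subset_affineSpan _ _ (mem_insert _ _)
    have hws : AffineMap.lineMap x z t ∈ affineSpan ℝ (insert x (A : Set V)) :=
      subset_affineSpan _ _ (mem_insert_of_mem _ hwA)
    have := AffineMap.lineMap_mem t⁻¹ hxs hws
    simpa [AffineMap.lineMap_apply, smul_smul, ht] using this
  have hEq : EqOn u p (Metric.ball y r) := by
    refine EqOn.of_subset_closure (s := Metric.ball y r ∩ (⋃ B ∈ (fun A : AffineSubspace ℝ V =>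
      affineSpan ℝ (insert x (A : Set V))) '' 𝒜, (B : Set V))ᶜ) (fun z hz => key z hz.1 hz.2)
      (hu.mono hball) p.continuous_of_finiteDimensional.continuousOn inter_subset_left ?_
    exact hdense.open_subset_closure_inter Metric.isOpen_ball
  exact hEq.eventuallyEq_of_mem (Metric.ball_mem_nhds y hr)

end LocallyAffine

variable {d : ℕ}

/-! ### Barycentric coordinates -/

/-- `β` is the family of barycentric coordinate functions of the `d`-simplex with vertices `K`. -/
structure IsBary (K : Finset (E d)) (β : E d → (E d →ᵃ[ℝ] ℝ)) : Prop where
  apply_self : ∀ a ∈ K, β a a = 1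
  apply_of_ne : ∀ a ∈ K, ∀ b ∈ K, a ≠ b → β a b = 0
  sum_eq_one : ∀ x, ∑ a ∈ K, β a x = 1
  sum_smul : ∀ x, ∑ a ∈ K, β a x • a = x

theorem exists_isBary {K : Finset (E d)} (hK : AffineIndependent ℝ ((↑) : K → E d))
    (hcard : K.card = d + 1) : ∃ β, IsBary K β := by
  classical
  have htop : affineSpan ℝ (range ((↑) : K → E d)) = ⊤ := by
    rw [hK.affineSpan_eq_top_iff_card_eq_finrank_add_one]
    simpa using hcard
  let b : AffineBasis K ℝ (E d) := ⟨(↑), hK, htop⟩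
  have hb : ∀ i : K, b i = i := fun i => rfl
  refine ⟨fun a => if h : a ∈ K then b.coord ⟨a, h⟩ else 0, ?_, ?_, ?_, ?_⟩
  · intro a ha
    simp only [ha, dif_pos]
    exact b.coord_apply_eq ⟨a, ha⟩
  · intro a ha c hc hac
    simp only [ha, dif_pos]
    exact b.coord_apply_ne (i := ⟨a, ha⟩) (j := ⟨c, hc⟩) (by simpa using hac)
  · intro x
    rw [← Finset.sum_attach, ← b.sum_coord_apply_eq_one x]
    exact Finset.sum_congr rfl fun a _ => by simp
  · intro x
    rw [← Finset.sum_attach]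
    conv_rhs => rw [← b.linear_combination_coord_eq_self x]
    exact Finset.sum_congr rfl fun a _ => by simp [hb]

open Classical in
/-- The barycentric coordinate functions of the simplex with vertices `K` (zero if degenerate). -/
def bary (K : Finset (E d)) : E d → (E d →ᵃ[ℝ] ℝ) :=
  if h : ∃ β, IsBary K β then h.choose else 0

theorem affineMap_sum_smul (p : E d →ᵃ[ℝ] ℝ) (s : Finset (E d)) (w : E d → ℝ)
    (hw : ∑ a ∈ s, w a = 1) : p (∑ a ∈ s, w a • a) = ∑ a ∈ s, w a * p a := by
  have h : ∀ x, p x = p.linear x + p 0 := fun x => by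
    simpa using congrFun (AffineMap.decomp p) x
  rw [h, map_sum]
  have h' : ∀ a ∈ s, w a * p a = p.linear (w a • a) + w a * p 0 := fun a _ => by
    rw [h a, map_smul, smul_eq_mul]
    ring
  rw [Finset.sum_congr rfl h', Finset.sum_add_distrib, ← Finset.sum_mul, hw, one_mul]

theorem hull_mono {s t : Finset (E d)} (h : s ⊆ t) : hull s ⊆ hull t :=
  convexHull_mono (by exact_mod_cast h)

theorem subset_hull {s : Finset (E d)} {x : E d} (h : x ∈ s) : x ∈ hull s :=
  subset_convexHull ℝ _ h

theorem convex_hull (s : Finset (E d)) : Convex ℝ (hull s) := convex_convexHull ℝ _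

theorem isCompact_hull (s : Finset (E d)) : IsCompact (hull s) :=
  s.finite_toSet.isCompact_convexHull ℝ

theorem hull_subset_affineSpan (s : Finset (E d)) : hull s ⊆ affineSpan ℝ (s : Set (E d)) :=
  convexHull_subset_affineSpan _

theorem affineMap_eq_zero_of_mem_affineSpan {p : E d →ᵃ[ℝ] ℝ} {s : Set (E d)}
    (h : ∀ a ∈ s, p a = 0) {x : E d} (hx : x ∈ affineSpan ℝ s) : p x = 0 := by
  refine affineSpan_induction hx h fun c u v w hu hv hw => ?_
  rw [AffineMap.map_vadd, map_smul, AffineMap.linearMap_vsub, hu, hv, hw]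
  simp

namespace IsBary

variable {K : Finset (E d)} {β : E d → (E d →ᵃ[ℝ] ℝ)} (h : IsBary K β)
include h

theorem apply_eq_sum (p : E d →ᵃ[ℝ] ℝ) (x : E d) : p x = ∑ a ∈ K, β a x * p a := by
  conv_lhs => rw [← h.sum_smul x]
  exact affineMap_sum_smul p K _ (h.sum_eq_one x)

theorem affineMap_ext {p q : E d →ᵃ[ℝ] ℝ} (hpq : ∀ a ∈ K, p a = q a) : p = q := by
  ext x
  rw [h.apply_eq_sum p, h.apply_eq_sum q]
  exact Finset.sum_congr rfl fun a ha => by rw [hpq a ha]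

theorem mem_hull_of_subset {F : Finset (E d)} (hF : F ⊆ K) {x : E d} (hx : ∀ a ∈ F, 0 ≤ β a x)
    (hx0 : ∀ a ∈ K, a ∉ F → β a x = 0) : x ∈ hull F := by
  refine Finset.mem_convexHull'.2 ⟨fun a => β a x, hx, ?_, ?_⟩
  · rw [← h.sum_eq_one x]
    exact Finset.sum_subset hF hx0
  · conv_rhs => rw [← h.sum_smul x]
    exact Finset.sum_subset hF fun a ha haF => by simp [hx0 a ha haF]

theorem nonneg_of_mem_hull {x : E d} (hx : x ∈ hull K) {a : E d} (ha : a ∈ K) : 0 ≤ β a x := by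
  obtain ⟨w, hw, hw1, rfl⟩ := Finset.mem_convexHull'.1 hx
  rw [affineMap_sum_smul _ _ _ hw1]
  refine Finset.sum_nonneg fun b hb => mul_nonneg (hw b hb) ?_
  by_cases hab : a = b
  · rw [← hab, h.apply_self a ha]; exact zero_le_one
  · rw [h.apply_of_ne a ha b hb hab]

theorem mem_hull_iff {x : E d} : x ∈ hull K ↔ ∀ a ∈ K, 0 ≤ β a x :=
  ⟨fun hx _ ha => h.nonneg_of_mem_hull hx ha,
    fun hx => h.mem_hull_of_subset subset_rfl hx fun _ ha hn => absurd ha hn⟩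

theorem eq_zero_of_mem_affineSpan {F : Finset (E d)} (hF : F ⊆ K) {a : E d} (ha : a ∈ K)
    (haF : a ∉ F) {x : E d} (hx : x ∈ affineSpan ℝ (F : Set (E d))) : β a x = 0 :=
  affineMap_eq_zero_of_mem_affineSpan
    (fun b hb => h.apply_of_ne a ha b (hF hb) fun hab => haF (hab ▸ hb)) hx

theorem eq_zero_of_mem_hull {F : Finset (E d)} (hF : F ⊆ K) {a : E d} (ha : a ∈ K)
    (haF : a ∉ F) {x : E d} (hx : x ∈ hull F) : β a x = 0 :=
  h.eq_zero_of_mem_affineSpan hF ha haF (hull_subset_affineSpan F hx)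

theorem mem_hull_erase [DecidableEq (E d)] {x : E d} (hx : x ∈ hull K) {a : E d}
    (h0 : β a x = 0) : x ∈ hull (K.erase a) := by
  refine h.mem_hull_of_subset (K.erase_subset a)
    (fun b hb => h.nonneg_of_mem_hull hx (Finset.mem_of_mem_erase hb)) fun b hb hbn => ?_
  obtain rfl : b = a := by
    by_contra hba
    exact hbn (Finset.mem_erase.2 ⟨hba, hb⟩)
  exact h0

theorem hull_mem_nhds {x : E d} (hx : ∀ a ∈ K, 0 < β a x) : hull K ∈ 𝓝 x := by
  have : ∀ᶠ y in 𝓝 x, ∀ a ∈ K, 0 < β a y := by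
    rw [Filter.eventually_all_finset]
    exact fun a ha => (β a).continuous_of_finiteDimensional.continuousAt.eventually_const_lt (hx a ha)
  filter_upwards [this] with y hy
  exact h.mem_hull_iff.2 fun a ha => (hy a ha).le

/-- The barycentre of a nonempty face. -/
theorem exists_barycentre {F : Finset (E d)} (hF : F ⊆ K) (hne : F.Nonempty) :
    ∃ x ∈ hull F, ∀ a ∈ F, 0 < β a x := by
  have hc : (0 : ℝ) < F.card := by exact_mod_cast hne.card_pos
  have h1 : ∑ a ∈ F, (F.card : ℝ)⁻¹ = 1 := by simp [hc.ne']
  refine ⟨∑ a ∈ F, (F.card : ℝ)⁻¹ • a, ?_, fun a ha => ?_⟩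
  · exact Finset.mem_convexHull'.2 ⟨fun _ => (F.card : ℝ)⁻¹, fun _ _ => by positivity, h1, rfl⟩
  · rw [affineMap_sum_smul (β a) F (fun _ => (F.card : ℝ)⁻¹) h1]
    refine Finset.sum_pos' (fun b hb => ?_) ⟨a, ha, ?_⟩
    · by_cases hab : a = b
      · rw [← hab, h.apply_self a (hF ha)]; positivity
      · rw [h.apply_of_ne a (hF ha) b (hF hb) hab, mul_zero]
    · rw [h.apply_self a (hF ha)]; positivity

theorem nonempty_interior : (interior (hull K)).Nonempty := by
  have hne : K.Nonempty := by
    by_contra hn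
    have := h.sum_eq_one 0
    simp [Finset.not_nonempty_iff_eq_empty.1 hn] at this
  obtain ⟨x, -, hx⟩ := h.exists_barycentre subset_rfl hne
  exact ⟨x, mem_interior_iff_mem_nhds.2 (h.hull_mem_nhds hx)⟩

end IsBary

/-! ### Adjacency of cells and facets, and neighbourhoods off the skeleton -/

namespace Triangulation

variable {Ω : Set (E d)} (T : Triangulation Ω)

theorem mem_cells {K : Finset (E d)} : K ∈ T.cells ↔ K ∈ T.faces ∧ K.card = d + 1 := by
  simp [cells]

theorem mem_facets {F : Finset (E d)} : F ∈ T.facets ↔ F ∈ T.faces ∧ F.card = d := by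
  simp [facets]

theorem mem_cellsAt {F K : Finset (E d)} : K ∈ T.cellsAt F ↔ K ∈ T.cells ∧ F ⊆ K := by
  simp [cellsAt]

variable {T}

theorem isBary {K : Finset (E d)} (hK : K ∈ T.cells) : IsBary K (bary K) := by
  have h := exists_isBary (T.indep (T.mem_cells.1 hK).1) (T.mem_cells.1 hK).2
  rw [bary, dif_pos h]
  exact h.choose_spec

variable (T) in
theorem closure_eq_biUnion_cells : closure Ω = ⋃ K ∈ T.cells, hull K := by
  rw [← T.space_eq]
  ext x
  simp only [Geometry.SimplicialComplex.mem_space_iff, mem_iUnion, exists_prop]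
  constructor
  · rintro ⟨s, hs, hx⟩
    obtain ⟨t, ht, hst, hc⟩ := T.pure s hs
    exact ⟨t, T.mem_cells.2 ⟨ht, hc⟩, hull_mono hst hx⟩
  · rintro ⟨K, hK, hx⟩
    exact ⟨K, (T.mem_cells.1 hK).1, hx⟩

theorem hull_subset_closure {K : Finset (E d)} (hK : K ∈ T.cells) : hull K ⊆ closure Ω := by
  rw [T.closure_eq_biUnion_cells]
  exact subset_biUnion_of_mem (u := fun K => hull K) hK

theorem exists_cell {x : E d} (hx : x ∈ closure Ω) : ∃ K ∈ T.cells, x ∈ hull K := by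
  rw [T.closure_eq_biUnion_cells] at hx
  simpa using hx

theorem isCompact_closure (T : Triangulation Ω) : IsCompact (closure Ω) := by
  rw [T.closure_eq_biUnion_cells]
  exact T.cells.isCompact_biUnion fun K _ => isCompact_hull K

variable (T) in
/-- The affine hulls of the faces of codimension at least two. -/
def skeleton : Set (AffineSubspace ℝ (E d)) :=
  (fun s : Finset (E d) => affineSpan ℝ (s : Set (E d))) '' {s ∈ T.faces | s.card < d}

variable (T) in
theorem finite_skeleton : T.skeleton.Finite := (T.finite_faces.subset (sep_subset _ _)).image _

theorem finrank_direction_of_face {s : Finset (E d)} (hs : s ∈ T.faces) :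
    finrank ℝ (affineSpan ℝ (s : Set (E d))).direction + 1 = s.card := by
  rw [direction_affineSpan]
  have hc : 0 < s.card := (T.nonempty_of_mem_faces hs).card_pos
  have := (T.indep hs).finrank_vectorSpan (n := s.card - 1) (by simp; omega)
  rw [Subtype.range_coe_subtype] at this
  have h2 : finrank ℝ (vectorSpan ℝ (s : Set (E d))) = s.card - 1 := this
  omega

theorem finrank_direction_skeleton {A : AffineSubspace ℝ (E d)} (hA : A ∈ T.skeleton) :
    finrank ℝ A.direction + 2 ≤ d := by
  obtain ⟨s, ⟨hs, hc⟩, rfl⟩ := hA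
  have := finrank_direction_of_face hs
  simp only
  omega

/-- A point off the skeleton lies in no face of codimension at least two. -/
theorem le_card_of_mem_hull {x : E d} (hx : ∀ A ∈ T.skeleton, x ∉ A) {s K : Finset (E d)}
    (hK : K ∈ T.faces) (hs : s ⊆ K) (hxs : x ∈ hull s) : d ≤ s.card := by
  by_contra! hlt
  have hne : s.Nonempty := by
    by_contra hn
    simp [Finset.not_nonempty_iff_eq_empty.1 hn, hull] at hxs
  exact hx _ ⟨s, ⟨T.down_closed hK hs hne, hlt⟩, rfl⟩ (hull_subset_affineSpan s hxs)

theorem mem_hull_inter [DecidableEq (E d)] {s t : Finset (E d)} (hs : s ∈ T.faces)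
    (ht : t ∈ T.faces) {x : E d} (hxs : x ∈ hull s) (hxt : x ∈ hull t) : x ∈ hull (s ∩ t) := by
  have := T.inter_subset_convexHull hs ht ⟨hxs, hxt⟩
  rwa [← Finset.coe_inter] at this

theorem exists_eq_insert [DecidableEq (E d)] {F K : Finset (E d)} (hF : F.card = d)
    (hK : K.card = d + 1) (hFK : F ⊆ K) : ∃ a ∉ F, insert a F = K := by
  obtain ⟨a, ha⟩ := Finset.exists_eq_insert_iff.2 ⟨hFK, by omega⟩
  exact ⟨a, ha⟩

/-- Two cells sharing a facet lie on opposite sides of it. -/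
theorem bary_neg_of_ne [DecidableEq (E d)] (hd : 0 < d) {F : Finset (E d)} {a b : E d}
    (haF : a ∉ F) (hbF : b ∉ F) (hF : F.card = d) (hab : a ≠ b) (ha : insert a F ∈ T.cells)
    (hb : insert b F ∈ T.cells) : bary (insert a F) a b < 0 := by
  -- Otherwise a short step `t` from the barycentre of `F` towards `b` stays in both cells, hence in
  -- the hull of their common vertices. The coordinate of `b` vanishes there, yet it equals `t > 0`.
  by_contra! hnn
  have hA := isBary ha
  have hB := isBary hb
  have haA : a ∈ insert a F := Finset.mem_insert_self a F
  have hbB : b ∈ insert b F := Finset.mem_insert_self b F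
  obtain ⟨x, hxF, hx⟩ := hA.exists_barycentre (Finset.subset_insert a F)
    (Finset.card_pos.1 (by omega))
  have hxa : bary (insert a F) a x = 0 :=
    hA.eq_zero_of_mem_hull (Finset.subset_insert a F) haA haF hxF
  have hxb : bary (insert b F) b x = 0 :=
    hB.eq_zero_of_mem_hull (Finset.subset_insert b F) hbB hbF hxF
  have hev : ∀ᶠ t : ℝ in 𝓝[>] 0, ∀ f ∈ F,
      0 < bary (insert a F) f (AffineMap.lineMap x b t) := by
    rw [Filter.eventually_all_finset]
    intro f hf
    have hc : Continuous fun t : ℝ => bary (insert a F) f (AffineMap.lineMap x b t) :=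
      (bary (insert a F) f).continuous_of_finiteDimensional.comp AffineMap.lineMap_continuous
    exact nhdsWithin_le_nhds (hc.continuousAt.eventually_const_lt (by simpa using hx f hf))
  obtain ⟨t, ⟨ht, ht1⟩, ht0⟩ := ((hev.and (nhdsWithin_le_nhds (eventually_lt_nhds one_pos))).and
    self_mem_nhdsWithin).exists
  have ht0 : 0 < t := ht0
  have hyA : AffineMap.lineMap x b t ∈ hull (insert a F) := by
    refine hA.mem_hull_iff.2 fun c hc => ?_
    rcases Finset.mem_insert.1 hc with rfl | hc
    · rw [AffineMap.apply_lineMap, hxa, AffineMap.lineMap_apply]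
      simpa using mul_nonneg ht0.le hnn
    · exact (ht c hc).le
  have hyB : AffineMap.lineMap x b t ∈ hull (insert b F) :=
    (convex_hull _).lineMap_mem (hull_mono (Finset.subset_insert b F) hxF) (subset_hull hbB)
      ⟨ht0.le, ht1.le⟩
  have hy := mem_hull_inter (T.mem_cells.1 ha).1 (T.mem_cells.1 hb).1 hyA hyB
  have hy0 := hB.eq_zero_of_mem_hull Finset.inter_subset_right hbB
    (by simp [Ne.symm hab, hbF]) hy
  rw [AffineMap.apply_lineMap, hxb, hB.apply_self b hbB] at hy0
  simp [AffineMap.lineMap_apply] at hy0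
  exact ht0.ne' hy0

/-- Both coordinates vanish on `F`, so they are proportional; the factor is read off at `b`. -/
theorem bary_eq_mul [DecidableEq (E d)] {F : Finset (E d)} {a b : E d}
    (haF : a ∉ F) (hbF : b ∉ F) (ha : insert a F ∈ T.cells)
    (hb : insert b F ∈ T.cells) (y : E d) :
    bary (insert a F) a y = bary (insert a F) a b * bary (insert b F) b y := by
  have hA := isBary ha
  have hB := isBary hb
  have : bary (insert a F) a = bary (insert a F) a b • bary (insert b F) b := by
    refine hB.affineMap_ext fun c hc => ?_
    rcases Finset.mem_insert.1 hc with rfl | hcF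
    · simp [hB.apply_self c hc]
    · have h1 : bary (insert a F) a c = 0 := hA.apply_of_ne a (Finset.mem_insert_self a F) c
        (Finset.mem_insert_of_mem hcF) (by rintro rfl; exact haF hcF)
      have h2 : bary (insert b F) b c = 0 := hB.apply_of_ne b (Finset.mem_insert_self b F) c
        (Finset.mem_insert_of_mem hcF) (by rintro rfl; exact hbF hcF)
      simp [h1, h2]
  exact congrArg (fun p : E d →ᵃ[ℝ] ℝ => p y) this

/-- Three apexes would lie pairwise on opposite sides of one hyperplane. In signs, the negative
number `β_a(c)` would equal the product `β_a(b) β_b(c)` of two negative ones. -/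
theorem card_cellsAt_le_two (hd : 0 < d) {F : Finset (E d)} (hF : F.card = d) :
    (T.cellsAt F).card ≤ 2 := by
  classical
  by_contra! h3
  obtain ⟨K₁, K₂, K₃, h₁, h₂, h₃, h12, h13, h23⟩ := Finset.two_lt_card_iff.1 h3
  rw [mem_cellsAt] at h₁ h₂ h₃
  obtain ⟨a, haF, rfl⟩ := exists_eq_insert hF (T.mem_cells.1 h₁.1).2 h₁.2
  obtain ⟨b, hbF, rfl⟩ := exists_eq_insert hF (T.mem_cells.1 h₂.1).2 h₂.2
  obtain ⟨c, hcF, rfl⟩ := exists_eq_insert hF (T.mem_cells.1 h₃.1).2 h₃.2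
  have hab : a ≠ b := by rintro rfl; exact h12 rfl
  have hac : a ≠ c := by rintro rfl; exact h13 rfl
  have hbc : b ≠ c := by rintro rfl; exact h23 rfl
  have n1 := bary_neg_of_ne hd haF hbF hF hab h₁.1 h₂.1
  have n2 := bary_neg_of_ne hd haF hcF hF hac h₁.1 h₃.1
  have n3 := bary_neg_of_ne hd hbF hcF hF hbc h₂.1 h₃.1
  have := bary_eq_mul haF hbF h₁.1 h₂.1 c
  nlinarith [mul_pos_of_neg_of_neg n1 n3]

/-- Off the skeleton, the two cells at a facet form a neighbourhood. -/
theorem hull_union_hull_mem_nhds (hd : 0 < d) {F K K' : Finset (E d)} (hF : F.card = d)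
    (hK : K ∈ T.cellsAt F) (hK' : K' ∈ T.cellsAt F) (hne : K ≠ K') {x : E d} (hxF : x ∈ hull F)
    (hx : ∀ A ∈ T.skeleton, x ∉ A) : hull K ∪ hull K' ∈ 𝓝 x := by
  classical
  rw [mem_cellsAt] at hK hK'
  -- If a coordinate of a vertex of `F` vanished at `x`, then `x` would lie in a face with `d - 1`
  -- vertices, hence on the skeleton.
  have pos : ∀ L ∈ T.cells, F ⊆ L → ∀ f ∈ F, 0 < bary L f x := by
    intro L hL hFL f hf
    have hB := isBary hL
    refine (hB.nonneg_of_mem_hull (hull_mono hFL hxF) (hFL hf)).lt_of_ne' fun h0 => ?_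
    have hxe : x ∈ hull (F.erase f) := by
      refine hB.mem_hull_of_subset ((F.erase_subset f).trans hFL)
        (fun a ha => hB.nonneg_of_mem_hull (hull_mono hFL hxF)
          (hFL (Finset.mem_of_mem_erase ha))) fun a haL han => ?_
      by_cases haf : a = f
      · rw [haf, h0]
      · exact hB.eq_zero_of_mem_hull hFL haL (fun haF => han (Finset.mem_erase.2 ⟨haf, haF⟩)) hxF
    have := le_card_of_mem_hull hx (T.mem_cells.1 hL).1 ((F.erase_subset f).trans hFL) hxe
    rw [Finset.card_erase_of_mem hf] at this
    omega
  have ev : ∀ L ∈ T.cells, F ⊆ L → ∀ᶠ y in 𝓝 x, ∀ f ∈ F, 0 < bary L f y := by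
    intro L hL hFL
    rw [Filter.eventually_all_finset]
    exact fun f hf => (bary L f).continuous_of_finiteDimensional.continuousAt.eventually_const_lt
      (pos L hL hFL f hf)
  have ev1 := ev K hK.1 hK.2
  have ev2 := ev K' hK'.1 hK'.2
  obtain ⟨a, haF, rfl⟩ := exists_eq_insert hF (T.mem_cells.1 hK.1).2 hK.2
  obtain ⟨b, hbF, rfl⟩ := exists_eq_insert hF (T.mem_cells.1 hK'.1).2 hK'.2
  have hab : a ≠ b := by rintro rfl; exact hne rfl
  have hneg := bary_neg_of_ne hd haF hbF hF hab hK.1 hK'.1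
  filter_upwards [ev1, ev2] with y hy1 hy2
  -- Near `x` only the sign of the apex coordinate matters; the two apex coordinates differ by a
  -- negative factor.
  rcases le_or_gt 0 (bary (insert a F) a y) with h | h
  · left
    refine (isBary hK.1).mem_hull_iff.2 fun c hc => ?_
    rcases Finset.mem_insert.1 hc with rfl | hc
    · exact h
    · exact (hy1 c hc).le
  · right
    refine (isBary hK'.1).mem_hull_iff.2 fun c hc => ?_
    rcases Finset.mem_insert.1 hc with rfl | hc
    · rw [bary_eq_mul haF hbF hK.1 hK'.1] at h
      by_contra! hcn
      nlinarith [mul_pos_of_neg_of_neg hneg hcn]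
    · exact (hy2 c hc).le

/-- Off the skeleton, a facet through an interior point belongs to a second cell. -/
theorem exists_ne_mem_cellsAt {F K : Finset (E d)} (hF : F.card = d)
    (hK : K ∈ T.cellsAt F) {x : E d} (hxF : x ∈ hull F) (hx : ∀ A ∈ T.skeleton, x ∉ A)
    (hxi : closure Ω ∈ 𝓝 x) : ∃ K' ∈ T.cellsAt F, K ≠ K' := by
  classical
  rw [mem_cellsAt] at hK
  have hB := isBary hK.1
  obtain ⟨a, haF, rfl⟩ := exists_eq_insert hF (T.mem_cells.1 hK.1).2 hK.2
  have ha : a ∈ insert a F := Finset.mem_insert_self a F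
  have hxa : bary (insert a F) a x = 0 := hB.eq_zero_of_mem_hull hK.2 ha haF hxF
  -- Cells are closed and finite in number, so a cell that meets a small enough neighbourhood of `x`
  -- contains `x`.
  have ev1 : ∀ᶠ y in 𝓝 x, ∀ L ∈ T.cells, y ∈ hull L → x ∈ hull L := by
    rw [Filter.eventually_all_finset]
    intro L _
    by_cases hxL : x ∈ hull L
    · exact Eventually.of_forall fun _ _ => hxL
    · filter_upwards [(isCompact_hull L).isClosed.isOpen_compl.mem_nhds hxL] with y hy hy'
      exact absurd hy' hy
  have hlim : Tendsto (fun t : ℝ => AffineMap.lineMap x a t) (𝓝[<] 0) (𝓝 x) := by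
    have := (AffineMap.lineMap_continuous (R := ℝ) (p := x) (q := a)).tendsto 0
    rw [AffineMap.lineMap_apply_zero] at this
    exact this.mono_left nhdsWithin_le_nhds
  -- A negative parameter moves away from the apex `a`, out of the cell across `F`; the cell `L`
  -- found there is the second one.
  obtain ⟨t, ⟨ht1, ht2⟩, ht⟩ := ((hlim.eventually (ev1.and hxi)).and self_mem_nhdsWithin).exists
  have ht : t < 0 := ht
  obtain ⟨L, hL, hyL⟩ := T.exists_cell ht2
  have hxL := ht1 L hL hyL
  -- Here `x` lies in the hull of `F ∩ L`, and off the skeleton that face cannot have fewer than `d`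
  -- vertices.
  have hFL : F ⊆ L := by
    have hmem := mem_hull_inter (T.down_closed (T.mem_cells.1 hK.1).1 hK.2
      (by by_contra hn; simp [Finset.not_nonempty_iff_eq_empty.1 hn, hull] at hxF))
      (T.mem_cells.1 hL).1 hxF hxL
    have := le_card_of_mem_hull hx (T.mem_cells.1 hL).1 Finset.inter_subset_right hmem
    exact Finset.inter_eq_left.1 (Finset.eq_of_subset_of_card_le Finset.inter_subset_left
      (by omega))
  refine ⟨L, T.mem_cellsAt.2 ⟨hL, hFL⟩, ?_⟩
  rintro rfl
  have := hB.nonneg_of_mem_hull hyL ha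
  rw [AffineMap.apply_lineMap, hxa, hB.apply_self a ha] at this
  simp [AffineMap.lineMap_apply] at this
  linarith

/-- A point of a cell without a neighbourhood in that cell lies in a facet of the cell. -/
theorem exists_facet_of_not_mem_nhds (hd : 0 < d) {K : Finset (E d)} (hK : K ∈ T.cells) {x : E d}
    (hxK : x ∈ hull K) (hx : hull K ∉ 𝓝 x) : ∃ F ∈ T.facets, K ∈ T.cellsAt F ∧ x ∈ hull F := by
  classical
  have hB := isBary hK
  obtain ⟨hKf, hc⟩ := T.mem_cells.1 hK
  obtain ⟨a, ha, h0⟩ : ∃ a ∈ K, bary K a x = 0 := by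
    by_contra! hne
    exact hx (hB.hull_mem_nhds fun a ha => (hB.nonneg_of_mem_hull hxK ha).lt_of_ne' (hne a ha))
  have hcard : (K.erase a).card = d := by rw [Finset.card_erase_of_mem ha]; omega
  exact ⟨K.erase a, T.mem_facets.2 ⟨T.down_closed hKf (K.erase_subset a)
    (Finset.card_pos.1 (by omega)), hcard⟩, T.mem_cellsAt.2 ⟨hK, K.erase_subset a⟩,
    hB.mem_hull_erase hxK h0⟩

theorem closure_mem_nhds_of_hull {K : Finset (E d)} (hK : K ∈ T.cells) {x : E d}
    (hx : hull K ∈ 𝓝 x) : closure Ω ∈ 𝓝 x := mem_of_superset hx (hull_subset_closure hK)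

theorem _root_.CIP.IsDomainSet.isOpen (hΩ : IsDomainSet Ω) : IsOpen Ω :=
  hΩ.regular ▸ isOpen_interior

/-- Regularity excludes slits: a boundary point with the closure on all sides would be interior. -/
theorem _root_.CIP.IsDomainSet.closure_notMem_nhds (hΩ : IsDomainSet Ω) {x : E d}
    (hx : x ∈ frontier Ω) : closure Ω ∉ 𝓝 x := by
  rw [← mem_interior_iff_mem_nhds, hΩ.regular]
  rw [hΩ.isOpen.frontier_eq] at hx
  exact hx.2

theorem exists_facet_of_mem_frontier (hd : 0 < d) (hΩ : IsDomainSet Ω) {x : E d}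
    (hx : x ∈ frontier Ω) : ∃ F ∈ T.facets, ∃ K ∈ T.cellsAt F, x ∈ hull F := by
  obtain ⟨K, hK, hxK⟩ := T.exists_cell (frontier_subset_closure hx)
  obtain ⟨F, hF, h⟩ := exists_facet_of_not_mem_nhds hd hK hxK
    fun h => hΩ.closure_notMem_nhds hx (closure_mem_nhds_of_hull hK h)
  exact ⟨F, hF, K, h⟩

/-- A second cell at the facet would, off the skeleton, complete a neighbourhood of `x` inside the
closure. -/
theorem exists_boundaryFacet_of_mem_frontier (hd : 0 < d) (hΩ : IsDomainSet Ω) {x : E d}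
    (hx : x ∈ frontier Ω) (hxs : ∀ A ∈ T.skeleton, x ∉ A) :
    ∃ F ∈ T.boundaryFacets, x ∈ hull F := by
  obtain ⟨F, hF, K, hK, hxF⟩ := T.exists_facet_of_mem_frontier hd hΩ hx
  refine ⟨F, Finset.mem_filter.2 ⟨hF, Finset.card_eq_one.2 ⟨K, Finset.eq_singleton_iff_unique_mem.2
    ⟨hK, fun K' hK' => ?_⟩⟩⟩, hxF⟩
  by_contra hne
  refine hΩ.closure_notMem_nhds hx (mem_of_superset
    (hull_union_hull_mem_nhds hd (T.mem_facets.1 hF).2 hK hK' (Ne.symm hne) hxF hxs) ?_)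
  exact union_subset (hull_subset_closure (T.mem_cellsAt.1 hK).1)
    (hull_subset_closure (T.mem_cellsAt.1 hK').1)

/-- Off the skeleton, a point of the domain has a neighbourhood in a cell or in the union of the two
cells at an interior facet through it. -/
theorem mem_nhds_of_mem_domain (hd : 0 < d) (hΩ : IsDomainSet Ω) {x : E d}
    (hx : x ∈ Ω) (hxs : ∀ A ∈ T.skeleton, x ∉ A) :
    (∃ K ∈ T.cells, hull K ∈ 𝓝 x) ∨ ∃ F ∈ T.interiorFacets, ∃ K ∈ T.cellsAt F,
      ∃ K' ∈ T.cellsAt F, K ≠ K' ∧ hull K ∪ hull K' ∈ 𝓝 x := by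
  classical
  have hxi : closure Ω ∈ 𝓝 x := mem_of_superset (hΩ.isOpen.mem_nhds hx) subset_closure
  obtain ⟨K, hK, hxK⟩ := T.exists_cell (subset_closure hx)
  by_cases hn : hull K ∈ 𝓝 x
  · exact Or.inl ⟨K, hK, hn⟩
  obtain ⟨F, hF, hKF, hxF⟩ := exists_facet_of_not_mem_nhds hd hK hxK hn
  have hFc := (T.mem_facets.1 hF).2
  obtain ⟨K', hK', hne⟩ := exists_ne_mem_cellsAt hFc hKF hxF hxs hxi
  refine Or.inr ⟨F, Finset.mem_filter.2 ⟨hF, le_antisymm (card_cellsAt_le_two hd hFc) ?_⟩, K, hKF,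
    K', hK', hne, hull_union_hull_mem_nhds hd hFc hKF hK' hne hxF hxs⟩
  exact Finset.one_lt_card.2 ⟨K, hKF, K', hK', hne⟩

end Triangulation

/-! ### Gradients on the cells -/

/-- The gradient of an affine function. -/
def affineGrad (p : E d →ᵃ[ℝ] ℝ) : E d :=
  (InnerProductSpace.toDual ℝ (E d)).symm (LinearMap.toContinuousLinearMap p.linear)

theorem inner_affineGrad (p : E d →ᵃ[ℝ] ℝ) (w : E d) : ⟪affineGrad p, w⟫_ℝ = p.linear w := by
  simp [affineGrad, InnerProductSpace.toDual_symm_apply]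

theorem affineMap_sub_eq_inner (p : E d →ᵃ[ℝ] ℝ) (x y : E d) :
    p y - p x = ⟪affineGrad p, y - x⟫_ℝ := by
  rw [inner_affineGrad, ← vsub_eq_sub y x, AffineMap.linearMap_vsub, vsub_eq_sub]

theorem affineGrad_add (p q : E d →ᵃ[ℝ] ℝ) : affineGrad (p + q) = affineGrad p + affineGrad q :=
  ext_inner_right ℝ fun w => by simp [inner_add_left, inner_affineGrad]

theorem affineGrad_smul (c : ℝ) (p : E d →ᵃ[ℝ] ℝ) : affineGrad (c • p) = c • affineGrad p :=
  ext_inner_right ℝ fun w => by simp [real_inner_smul_left, inner_affineGrad]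

theorem hasFDerivAt_affineMap (p : E d →ᵃ[ℝ] ℝ) (x : E d) :
    HasFDerivAt p (LinearMap.toContinuousLinearMap p.linear) x := by
  have h := (LinearMap.toContinuousLinearMap p.linear).hasFDerivAt (x := x) |>.add_const (p 0)
  refine h.congr_of_eventuallyEq (Eventually.of_forall fun y => ?_)
  simpa using congrFun (AffineMap.decomp p) y

section Within

variable {s : Set (E d)} {v : E d → ℝ} {p : E d →ᵃ[ℝ] ℝ} {x : E d}

/-- Unique differentiability makes the one-sided derivative meaningful also at boundary points of a
cell, where the penalty terms evaluate it. -/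
theorem fderivWithin_eq_of_eqOn_affine (hs : UniqueDiffOn ℝ s) (hv : EqOn v p s) (hx : x ∈ s) :
    fderivWithin ℝ v s x = LinearMap.toContinuousLinearMap p.linear := by
  rw [fderivWithin_congr hv (hv hx)]
  exact (hasFDerivAt_affineMap p x).hasFDerivWithinAt.fderivWithin (hs x hx)

theorem gradientWithin_eq_of_eqOn_affine (hs : UniqueDiffOn ℝ s) (hv : EqOn v p s) (hx : x ∈ s) :
    gradientWithin v s x = affineGrad p := by
  rw [gradientWithin, fderivWithin_eq_of_eqOn_affine hs hv hx, affineGrad]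

theorem laplacianWithin_eq_zero_of_eqOn_affine (hs : UniqueDiffOn ℝ s) (hv : EqOn v p s)
    (hx : x ∈ s) : InnerProductSpace.laplacianWithin v s x = 0 := by
  rw [InnerProductSpace.laplacianWithin_eq_iteratedFDerivWithin_stdOrthonormalBasis v hs hx]
  refine Finset.sum_eq_zero fun i _ => ?_
  rw [iteratedFDerivWithin_two_apply _ hs hx]
  have h : EqOn (fderivWithin ℝ v s) (fun _ => LinearMap.toContinuousLinearMap p.linear) s :=
    fun y hy => fderivWithin_eq_of_eqOn_affine hs hv hy
  rw [fderivWithin_congr h (h hx)]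
  simp

end Within

namespace Triangulation

variable {Ω : Set (E d)} {T : Triangulation Ω}

theorem uniqueDiffOn_hull {K : Finset (E d)} (hK : K ∈ T.cells) : UniqueDiffOn ℝ (hull K) :=
  uniqueDiffOn_convex (convex_hull K) (isBary hK).nonempty_interior

/-- The gradient is constant on a cell, so evaluating it at one fixed point gives a linear map. The
stabilisation thereby becomes a bilinear form. -/
theorem exists_linearMap_grad {K : Finset (E d)} (hK : K ∈ T.cells) :
    ∃ G : T.P1 →ₗ[ℝ] E d, ∀ v : T.P1, ∀ p : E d →ᵃ[ℝ] ℝ, EqOn (v : E d → ℝ) p (hull K) →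
      G v = affineGrad p := by
  obtain ⟨x, hx⟩ := (isBary hK).nonempty_interior
  have hx := interior_subset hx
  have hG : ∀ v : T.P1, ∀ p : E d →ᵃ[ℝ] ℝ, EqOn (v : E d → ℝ) p (hull K) →
      grad K v x = affineGrad p := fun v p hp =>
    gradientWithin_eq_of_eqOn_affine (uniqueDiffOn_hull hK) hp hx
  refine ⟨⟨⟨fun v => grad K v x, fun u v => ?_⟩, fun c v => ?_⟩, hG⟩
  · obtain ⟨p, hp⟩ := u.2.2.2 K hK
    obtain ⟨q, hq⟩ := v.2.2.2 K hK
    rw [hG u p hp, hG v q hq, hG (u + v) (p + q) fun y hy => by simp [hp hy, hq hy],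
      affineGrad_add]
  · obtain ⟨p, hp⟩ := v.2.2.2 K hK
    simp only [RingHom.id_apply]
    rw [hG v p hp, hG (c • v) (c • p) fun y hy => by simp [hp hy], affineGrad_smul]

variable (T) in
open Classical in
/-- The gradient on the cell `K`, as a linear map on the discrete space. -/
def cellGrad (K : Finset (E d)) : T.P1 →ₗ[ℝ] E d :=
  if hK : K ∈ T.cells then (exists_linearMap_grad hK).choose else 0

theorem cellGrad_eq {K : Finset (E d)} (hK : K ∈ T.cells) (v : T.P1) {p : E d →ᵃ[ℝ] ℝ}
    (hp : EqOn (v : E d → ℝ) p (hull K)) : T.cellGrad K v = affineGrad p := by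
  rw [cellGrad, dif_pos hK]
  exact (exists_linearMap_grad hK).choose_spec v p hp

theorem grad_eq_cellGrad {K : Finset (E d)} (hK : K ∈ T.cells) (v : T.P1) {x : E d}
    (hx : x ∈ hull K) : grad K v x = T.cellGrad K v := by
  obtain ⟨p, hp⟩ := v.2.2.2 K hK
  rw [cellGrad_eq hK v hp]
  exact gradientWithin_eq_of_eqOn_affine (uniqueDiffOn_hull hK) hp hx

theorem lap_eq_zero {K : Finset (E d)} (hK : K ∈ T.cells) (v : T.P1) {x : E d}
    (hx : x ∈ hull K) : lap K v x = 0 := by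
  obtain ⟨p, hp⟩ := v.2.2.2 K hK
  exact laplacianWithin_eq_zero_of_eqOn_affine (uniqueDiffOn_hull hK) hp hx

theorem sub_eq_inner_cellGrad {K : Finset (E d)} (hK : K ∈ T.cells) (v : T.P1) {x y : E d}
    (hx : x ∈ hull K) (hy : y ∈ hull K) :
    (v : E d → ℝ) y - (v : E d → ℝ) x = ⟪T.cellGrad K v, y - x⟫_ℝ := by
  obtain ⟨p, hp⟩ := v.2.2.2 K hK
  rw [cellGrad_eq hK v hp, hp hx, hp hy, affineMap_sub_eq_inner]

/-! ### Facets: normals and measure -/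

/-- The barycentric coordinate of the apex vanishes on `F` and is nonnegative at the vertices of
`K`, so minus its normalised gradient is an outer normal, and the choice in `outerNormal` is
legitimate. -/
theorem isOuterNormal_outerNormal {F K : Finset (E d)} (hd : 0 < d) (hF : F.card = d)
    (hK : K ∈ T.cellsAt F) : IsOuterNormal K F (outerNormal K F) := by
  classical
  rw [mem_cellsAt] at hK
  have hB := isBary hK.1
  refine Classical.epsilon_spec (p := IsOuterNormal K F) ?_
  obtain ⟨a, haF, rfl⟩ := exists_eq_insert hF (T.mem_cells.1 hK.1).2 hK.2
  have ha : a ∈ insert a F := Finset.mem_insert_self a F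
  set p := bary (insert a F) a with hp
  have hpF : ∀ f ∈ F, p f = 0 := fun f hf => hB.apply_of_ne a ha f (Finset.mem_insert_of_mem hf)
    (by rintro rfl; exact haF hf)
  have hpa : p a = 1 := hB.apply_self a ha
  have hg : 0 < ‖affineGrad p‖ := by
    rw [norm_pos_iff]
    intro h0
    obtain ⟨f, hf⟩ := Finset.card_pos.1 (hF ▸ hd)
    have := affineMap_sub_eq_inner p f a
    rw [h0, hpa, hpF f hf, inner_zero_left] at this
    norm_num at this
  have hin : ∀ x ∈ F, ∀ y, ⟪-(‖affineGrad p‖⁻¹ • affineGrad p), y - x⟫_ℝ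
      = -(‖affineGrad p‖⁻¹ * p y) := fun x hx y => by
    rw [inner_neg_left, real_inner_smul_left, ← affineMap_sub_eq_inner, hpF x hx, sub_zero]
  refine ⟨-(‖affineGrad p‖⁻¹ • affineGrad p), ?_, fun x hx y hy => ?_, fun x hx y hy => ?_⟩
  · rw [norm_neg, norm_smul, norm_inv, norm_norm, inv_mul_cancel₀ hg.ne']
  · rw [hin x hx, hpF y hy]; simp
  · rw [hin x hx, neg_nonpos]
    refine mul_nonneg (inv_nonneg.2 hg.le) ?_
    rcases Finset.mem_insert.1 hy with rfl | hy
    · rw [hpa]; exact zero_le_one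
    · rw [hpF y hy]

theorem finrank_direction_of_facet {F : Finset (E d)} (hF : F ∈ T.facets) :
    finrank ℝ (affineSpan ℝ (F : Set (E d))).direction = d - 1 := by
  have h := T.mem_facets.1 hF
  have := finrank_direction_of_face h.1
  omega

theorem measure_hull_lt_top {F : Finset (E d)} (hF : F ∈ T.facets) : μHE[d - 1] (hull F) < ⊤ :=
  euclideanHausdorffMeasure_lt_top_of_isBounded (hull_subset_affineSpan F)
    (isCompact_hull F).isBounded (finrank_direction_of_facet hF)

/-- Near its barycentre the facet fills its hyperplane. -/
theorem measure_hull_pos {F K : Finset (E d)} (hF : F ∈ T.facets) (hK : K ∈ T.cellsAt F) :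
    0 < μHE[d - 1] (hull F) := by
  rw [mem_cellsAt] at hK
  have hB := isBary hK.1
  obtain ⟨x, hxF, hx⟩ := hB.exists_barycentre hK.2 (T.nonempty_of_mem_faces (T.mem_facets.1 hF).1)
  have hev : ∀ᶠ y in 𝓝 x, ∀ f ∈ F, 0 < bary K f y := by
    rw [Filter.eventually_all_finset]
    exact fun f hf => (bary K f).continuous_of_finiteDimensional.continuousAt.eventually_const_lt
      (hx f hf)
  obtain ⟨r, hr, hball⟩ := Metric.eventually_nhds_iff_ball.1 hev
  refine (euclideanHausdorffMeasure_inter_ball_pos (hull_subset_affineSpan F hxF) hr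
    (finrank_direction_of_facet hF)).trans_le (measure_mono ?_)
  rintro y ⟨hyA, hyB⟩
  exact hB.mem_hull_of_subset hK.2 (fun f hf => (hball y hyB f hf).le)
    fun a ha haF => hB.eq_zero_of_mem_affineSpan hK.2 ha haF hyA

theorem measure_frontier_lt_top (T : Triangulation Ω) (hd : 0 < d) (hΩ : IsDomainSet Ω) :
    μHE[d - 1] (frontier Ω) < ⊤ := by
  have hsub : frontier Ω ⊆ ⋃ F ∈ T.facets, hull F := by
    intro x hx
    obtain ⟨F, hF, -, -, hxF⟩ := T.exists_facet_of_mem_frontier hd hΩ hx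
    exact mem_biUnion hF hxF
  refine (measure_mono hsub).trans_lt ((measure_biUnion_finset_le _ _).trans_lt ?_)
  exact ENNReal.sum_lt_top.2 fun F hF => measure_hull_lt_top hF

theorem measure_skeleton_eq_zero (T : Triangulation Ω) (hd : 0 < d) :
    μHE[d - 1] (⋃ A ∈ T.skeleton, (A : Set (E d))) = 0 := by
  rw [measure_biUnion_null_iff T.finite_skeleton.countable]
  intro A hA
  refine euclideanHausdorffMeasure_affineSubspace_eq_zero A ?_
  have := finrank_direction_skeleton hA
  omega

/-! ### Mesh size -/

theorem cells_nonempty (T : Triangulation Ω) (hΩ : IsDomainSet Ω) : T.cells.Nonempty := by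
  obtain ⟨x, hx⟩ := hΩ.connected.nonempty
  obtain ⟨K, hK, -⟩ := T.exists_cell (subset_closure hx)
  exact ⟨K, hK⟩

theorem diam_hull_pos {s : Finset (E d)} (h : 1 < s.card) : 0 < Metric.diam (hull s) := by
  obtain ⟨a, ha, b, hb, hab⟩ := Finset.one_lt_card.1 h
  exact (dist_pos.2 hab).trans_le
    (Metric.dist_le_diam_of_mem (isCompact_hull s).isBounded (subset_hull ha) (subset_hull hb))

theorem meshSize_pos (T : Triangulation Ω) (hd : 0 < d) (hΩ : IsDomainSet Ω) : 0 < T.meshSize := by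
  obtain ⟨K, hK⟩ := T.cells_nonempty hΩ
  refine (diam_hull_pos (s := K) (by rw [(T.mem_cells.1 hK).2]; omega)).trans_le ?_
  exact le_ciSup (f := fun K : T.cells => Metric.diam (hull K.1)) (Set.finite_range _).bddAbove
    ⟨K, hK⟩

end Triangulation

variable {Ω : Set (E d)} {T : Triangulation Ω} {γ₁ γ₂ : Finset (E d) → ℝ} {μ : ℝ}
  {B : WeakBC Ω}

/-! ### The stabilisation as a bilinear form -/

open Triangulation

/-- On cells gradients are constant and Laplacians vanish, so each integral is a measure times a
constant. -/
theorem scip_eq_sum (u v : T.P1) : scip T γ₁ γ₂ u v = ∑ F ∈ T.interiorFacets, (1 / 2 : ℝ) *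
    ∑ p ∈ (T.cellsAt F).offDiag, μHE[d - 1].real (hull F) * (Metric.diam (hull F) * γ₁ F) *
      ⟪T.cellGrad p.1 u - T.cellGrad p.2 u, T.cellGrad p.1 v - T.cellGrad p.2 v⟫_ℝ := by
  refine Finset.sum_congr rfl fun F _ => congrArg _ (Finset.sum_congr rfl fun p hp => ?_)
  obtain ⟨h1, h2, -⟩ := Finset.mem_offDiag.1 hp
  rw [mem_cellsAt] at h1 h2
  rw [setIntegral_congr_fun (g := fun _ => Metric.diam (hull F) * γ₁ F *
    ⟪T.cellGrad p.1 u - T.cellGrad p.2 u, T.cellGrad p.1 v - T.cellGrad p.2 v⟫_ℝ)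
    (isCompact_hull F).measurableSet, setIntegral_const, smul_eq_mul]
  · ring
  intro x hx
  have hx1 := hull_mono h1.2 hx
  have hx2 := hull_mono h2.2 hx
  simp only [grad_eq_cellGrad h1.1 _ hx1, grad_eq_cellGrad h2.1 _ hx2, lap_eq_zero h1.1 _ hx1,
    lap_eq_zero h2.1 _ hx2]
  simp

theorem neumannPenalty_eq_sum (u v : T.P1) : neumannPenalty T B u v =
    ∑ F ∈ T.boundaryFacets, ∑ K ∈ T.cellsAt F, μHE[d - 1].real (hull F ∩ B.ΓN) *
      (B.γN * T.meshSize) *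
      (⟪T.cellGrad K u, outerNormal K F⟫_ℝ * ⟪T.cellGrad K v, outerNormal K F⟫_ℝ) := by
  refine Finset.sum_congr rfl fun F _ => Finset.sum_congr rfl fun K hK => ?_
  rw [mem_cellsAt] at hK
  rw [setIntegral_congr_fun (g := fun _ => B.γN * T.meshSize *
    (⟪T.cellGrad K u, outerNormal K F⟫_ℝ * ⟪T.cellGrad K v, outerNormal K F⟫_ℝ))
    ((isCompact_hull F).measurableSet.inter B.measurableSet_ΓN), setIntegral_const, smul_eq_mul]
  · ring
  intro x hx
  simp only [grad_eq_cellGrad hK.1 _ (hull_mono hK.2 hx.1)]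

/-- Integrability is needed for additivity of the integral, and to conclude from a zero integral
that a nonnegative integrand vanishes almost everywhere. -/
theorem integrableOn_dirichlet (hd : 0 < d) (hΩ : IsDomainSet Ω) (c : ℝ) (u v : T.P1) :
    IntegrableOn (fun x => c * ((u : E d → ℝ) x * (v : E d → ℝ) x)) B.ΓD μHE[d - 1] := by
  refine ContinuousOn.integrableOn_of_subset_isCompact (K := closure Ω)
    (continuousOn_const.mul (u.2.1.mul v.2.1)) T.isCompact_closure B.measurableSet_ΓD
    (B.ΓD_subset.trans frontier_subset_closure) ?_
  exact ((measure_mono B.ΓD_subset).trans_lt (T.measure_frontier_lt_top hd hΩ)).ne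

theorem exists_scipForm (T : Triangulation Ω) (γ₁ γ₂ : Finset (E d) → ℝ) :
    ∃ S : T.P1 →ₗ[ℝ] T.P1 →ₗ[ℝ] ℝ, ∀ u v, S u v = scip T γ₁ γ₂ u v := by
  refine ⟨∑ F ∈ T.interiorFacets, (1 / 2 : ℝ) • ∑ p ∈ (T.cellsAt F).offDiag,
    (μHE[d - 1].real (hull F) * (Metric.diam (hull F) * γ₁ F)) •
      (innerₗ (E d)).compl₁₂ (T.cellGrad p.1 - T.cellGrad p.2) (T.cellGrad p.1 - T.cellGrad p.2),
    fun u v => ?_⟩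
  rw [scip_eq_sum]
  simp [LinearMap.sum_apply, inner_sub_left]

theorem exists_neumannForm (T : Triangulation Ω) (B : WeakBC Ω) :
    ∃ S : T.P1 →ₗ[ℝ] T.P1 →ₗ[ℝ] ℝ, ∀ u v, S u v = neumannPenalty T B u v := by
  refine ⟨∑ F ∈ T.boundaryFacets, ∑ K ∈ T.cellsAt F,
    (μHE[d - 1].real (hull F ∩ B.ΓN) * (B.γN * T.meshSize)) •
      (LinearMap.mul ℝ ℝ).compl₁₂ (innerₗ (E d) (outerNormal K F) ∘ₗ T.cellGrad K)
        (innerₗ (E d) (outerNormal K F) ∘ₗ T.cellGrad K), fun u v => ?_⟩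
  rw [neumannPenalty_eq_sum]
  simp [LinearMap.sum_apply, real_inner_comm]

theorem exists_dirichletForm (hd : 0 < d) (hΩ : IsDomainSet Ω) (T : Triangulation Ω) (μ : ℝ)
    (B : WeakBC Ω) :
    ∃ S : T.P1 →ₗ[ℝ] T.P1 →ₗ[ℝ] ℝ, ∀ u v, S u v = dirichletPenalty T μ B u v := by
  have hint := fun u v : T.P1 =>
    integrableOn_dirichlet (B := B) hd hΩ (B.γD * μ * (T.meshSize)⁻¹) u v
  refine ⟨LinearMap.mk₂ ℝ (fun u v : T.P1 => dirichletPenalty T μ B u v) ?_ ?_ ?_ ?_,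
    fun _ _ => rfl⟩
  · intro u u' v
    simp only [dirichletPenalty]
    rw [← integral_add (hint u v) (hint u' v)]
    refine integral_congr_ae (Eventually.of_forall fun x => ?_)
    simp only [Submodule.coe_add, Pi.add_apply]
    ring
  · intro c u v
    simp only [dirichletPenalty]
    rw [← integral_smul]
    refine integral_congr_ae (Eventually.of_forall fun x => ?_)
    simp only [Submodule.coe_smul, Pi.smul_apply, smul_eq_mul]
    ring
  · intro u v v'
    simp only [dirichletPenalty]
    rw [← integral_add (hint u v) (hint u v')]
    refine integral_congr_ae (Eventually.of_forall fun x => ?_)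
    simp only [Submodule.coe_add, Pi.add_apply]
    ring
  · intro c u v
    simp only [dirichletPenalty]
    rw [← integral_smul]
    refine integral_congr_ae (Eventually.of_forall fun x => ?_)
    simp only [Submodule.coe_smul, Pi.smul_apply, smul_eq_mul]
    ring

theorem exists_stabForm (hd : 0 < d) (hΩ : IsDomainSet Ω) (T : Triangulation Ω)
    (γ₁ γ₂ : Finset (E d) → ℝ) (μ : ℝ) (B : WeakBC Ω) :
    ∃ S : T.P1 →ₗ[ℝ] T.P1 →ₗ[ℝ] ℝ, ∀ u v, S u v = stab T γ₁ γ₂ μ B u v := by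
  obtain ⟨S₁, h₁⟩ := exists_scipForm T γ₁ γ₂
  obtain ⟨S₂, h₂⟩ := exists_dirichletForm hd hΩ T μ B
  obtain ⟨S₃, h₃⟩ := exists_neumannForm T B
  exact ⟨S₁ + S₂ + S₃, fun u v => by simp [stab, h₁, h₂, h₃]⟩

/-! ### Definiteness -/

theorem scip_summand_nonneg (hγ₁ : ∀ F ∈ T.interiorFacets, 0 < γ₁ F) (u : T.P1)
    {F : Finset (E d)} (hF : F ∈ T.interiorFacets) (p : Finset (E d) × Finset (E d)) :
    0 ≤ μHE[d - 1].real (hull F) * (Metric.diam (hull F) * γ₁ F) *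
      ⟪T.cellGrad p.1 u - T.cellGrad p.2 u, T.cellGrad p.1 u - T.cellGrad p.2 u⟫_ℝ :=
  mul_nonneg (mul_nonneg measureReal_nonneg (mul_nonneg Metric.diam_nonneg (hγ₁ F hF).le))
    real_inner_self_nonneg

theorem scip_self_nonneg (hγ₁ : ∀ F ∈ T.interiorFacets, 0 < γ₁ F) (u : T.P1) :
    0 ≤ scip T γ₁ γ₂ u u := by
  rw [scip_eq_sum]
  exact Finset.sum_nonneg fun F hF => mul_nonneg (by norm_num)
    (Finset.sum_nonneg fun p _ => scip_summand_nonneg hγ₁ u hF p)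

theorem cellGrad_eq_of_scip_self_eq_zero (hd : 1 < d) (hγ₁ : ∀ F ∈ T.interiorFacets, 0 < γ₁ F)
    {u : T.P1} (hu : scip T γ₁ γ₂ u u = 0) {F K K' : Finset (E d)} (hF : F ∈ T.interiorFacets)
    (hK : K ∈ T.cellsAt F) (hK' : K' ∈ T.cellsAt F) : T.cellGrad K u = T.cellGrad K' u := by
  by_cases hne : K = K'
  · rw [hne]
  rw [scip_eq_sum, Finset.sum_eq_zero_iff_of_nonneg fun F hF => mul_nonneg (by norm_num)
    (Finset.sum_nonneg fun p _ => scip_summand_nonneg hγ₁ u hF p)] at hu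
  have h1 := (mul_eq_zero.1 (hu F hF)).resolve_left (by norm_num)
  rw [Finset.sum_eq_zero_iff_of_nonneg fun p _ => scip_summand_nonneg hγ₁ u hF p] at h1
  have h2 := h1 (K, K') (Finset.mem_offDiag.2 ⟨hK, hK', hne⟩)
  have hFf := (Finset.mem_filter.1 hF).1
  have hm : 0 < μHE[d - 1].real (hull F) :=
    ENNReal.toReal_pos (measure_hull_pos hFf hK).ne' (measure_hull_lt_top hFf).ne
  -- Here `1 < d` is essential: for `d = 1` a facet is a point, with `h_F = 0`.
  have hdiam : 0 < Metric.diam (hull F) := diam_hull_pos (by rw [(T.mem_facets.1 hFf).2]; exact hd)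
  have h3 := (mul_eq_zero.1 h2).resolve_left (mul_pos hm (mul_pos hdiam (hγ₁ F hF))).ne'
  exact sub_eq_zero.1 (inner_self_eq_zero.1 h3)

theorem dirichlet_integrand_nonneg (hμ : 0 < μ) (T : Triangulation Ω) (B : WeakBC Ω)
    (u : E d → ℝ) (x : E d) : 0 ≤ B.γD * μ * (T.meshSize)⁻¹ * (u x * u x) :=
  mul_nonneg (mul_nonneg (mul_nonneg B.γD_pos.le hμ.le)
    (inv_nonneg.2 (Real.iSup_nonneg fun _ => Metric.diam_nonneg))) (mul_self_nonneg _)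

theorem dirichletPenalty_self_nonneg (hμ : 0 < μ) (T : Triangulation Ω) (B : WeakBC Ω)
    (u : E d → ℝ) : 0 ≤ dirichletPenalty T μ B u u :=
  integral_nonneg fun x => dirichlet_integrand_nonneg hμ T B u x

theorem ae_eq_zero_of_dirichletPenalty_self (hd : 0 < d) (hΩ : IsDomainSet Ω) (hμ : 0 < μ)
    {u : T.P1} (hu : dirichletPenalty T μ B u u = 0) :
    ∀ᵐ x ∂(μHE[d - 1].restrict B.ΓD), (u : E d → ℝ) x = 0 := by
  have := (integral_eq_zero_iff_of_nonneg (fun x => dirichlet_integrand_nonneg hμ T B u x)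
    (integrableOn_dirichlet hd hΩ _ u u)).1 hu
  filter_upwards [this] with x hx
  have hc : 0 < B.γD * μ * (T.meshSize)⁻¹ :=
    mul_pos (mul_pos B.γD_pos hμ) (inv_pos.2 (T.meshSize_pos hd hΩ))
  exact mul_self_eq_zero.1 ((mul_eq_zero.1 hx).resolve_left hc.ne')

theorem neumann_summand_nonneg (T : Triangulation Ω) (B : WeakBC Ω) (u : T.P1)
    (F K : Finset (E d)) : 0 ≤ μHE[d - 1].real (hull F ∩ B.ΓN) * (B.γN * T.meshSize) *
      (⟪T.cellGrad K u, outerNormal K F⟫_ℝ * ⟪T.cellGrad K u, outerNormal K F⟫_ℝ) :=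
  mul_nonneg (mul_nonneg measureReal_nonneg (mul_nonneg B.γN_pos.le
    (Real.iSup_nonneg fun _ => Metric.diam_nonneg))) (mul_self_nonneg _)

theorem neumannPenalty_self_nonneg (u : T.P1) : 0 ≤ neumannPenalty T B u u := by
  rw [neumannPenalty_eq_sum]
  exact Finset.sum_nonneg fun F _ => Finset.sum_nonneg fun K _ => neumann_summand_nonneg T B u F K

theorem inner_outerNormal_eq_zero_of_neumannPenalty_self (hd : 0 < d) (hΩ : IsDomainSet Ω)
    {u : T.P1} (hu : neumannPenalty T B u u = 0) {F K : Finset (E d)} (hF : F ∈ T.boundaryFacets)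
    (hK : K ∈ T.cellsAt F) (hm : 0 < μHE[d - 1] (hull F ∩ B.ΓN)) :
    ⟪T.cellGrad K u, outerNormal K F⟫_ℝ = 0 := by
  rw [neumannPenalty_eq_sum, Finset.sum_eq_zero_iff_of_nonneg fun F _ =>
    Finset.sum_nonneg fun K _ => neumann_summand_nonneg T B u F K] at hu
  have h1 := hu F hF
  rw [Finset.sum_eq_zero_iff_of_nonneg fun K _ => neumann_summand_nonneg T B u F K] at h1
  have hm' : 0 < μHE[d - 1].real (hull F ∩ B.ΓN) := ENNReal.toReal_pos hm.ne'
    ((measure_mono inter_subset_left).trans_lt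
      (measure_hull_lt_top (Finset.mem_filter.1 hF).1)).ne
  exact mul_self_eq_zero.1 ((mul_eq_zero.1 (h1 K hK)).resolve_left
    (mul_pos hm' (mul_pos B.γN_pos (T.meshSize_pos hd hΩ))).ne')

theorem stab_self_nonneg (hγ₁ : ∀ F ∈ T.interiorFacets, 0 < γ₁ F) (hμ : 0 < μ) (u : T.P1) :
    0 ≤ stab T γ₁ γ₂ μ B u u :=
  add_nonneg (add_nonneg (scip_self_nonneg hγ₁ u) (dirichletPenalty_self_nonneg hμ T B u))
    (neumannPenalty_self_nonneg u)

theorem parts_eq_zero_of_stab_self (hγ₁ : ∀ F ∈ T.interiorFacets, 0 < γ₁ F) (hμ : 0 < μ)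
    {u : T.P1} (hu : stab T γ₁ γ₂ μ B u u = 0) :
    scip T γ₁ γ₂ u u = 0 ∧ dirichletPenalty T μ B u u = 0 ∧ neumannPenalty T B u u = 0 := by
  have h1 := scip_self_nonneg (γ₂ := γ₂) hγ₁ u
  have h2 := dirichletPenalty_self_nonneg hμ T B (u : E d → ℝ)
  have h3 := neumannPenalty_self_nonneg (B := B) u
  rw [stab] at hu
  refine ⟨?_, ?_, ?_⟩ <;> linarith

/-- Discrete functions in the kernel of the stabilisation are globally affine. -/
theorem exists_affineMap_of_scip_self_eq_zero (hd : 1 < d) (hΩ : IsDomainSet Ω)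
    (hγ₁ : ∀ F ∈ T.interiorFacets, 0 < γ₁ F) {u : T.P1} (hu : scip T γ₁ γ₂ u u = 0) :
    ∃ p : E d →ᵃ[ℝ] ℝ, EqOn (u : E d → ℝ) p (closure Ω) := by
  have hloc : ∀ x ∈ Ω, (∀ A ∈ T.skeleton, x ∉ A) →
      ∃ p : E d →ᵃ[ℝ] ℝ, (u : E d → ℝ) =ᶠ[𝓝 x] p := by
    intro x hx hxs
    rcases mem_nhds_of_mem_domain (by omega) hΩ hx hxs with
      ⟨K, hK, hn⟩ | ⟨F, hF, K, hK, K', hK', -, hn⟩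
    · obtain ⟨p, hp⟩ := u.2.2.2 K hK
      exact ⟨p, hp.eventuallyEq_of_mem hn⟩
    · have hg := cellGrad_eq_of_scip_self_eq_zero hd hγ₁ hu hF hK hK'
      obtain ⟨f, hf⟩ := T.nonempty_of_mem_faces (T.mem_facets.1 (Finset.mem_filter.1 hF).1).1
      rw [mem_cellsAt] at hK hK'
      obtain ⟨p, hp⟩ := u.2.2.2 K hK.1
      refine ⟨p, EqOn.eventuallyEq_of_mem ?_ hn⟩
      rintro y (hy | hy)
      · exact hp hy
      -- Equal gradients and the common vertex `f` extend the affine function of `K` to `K'`.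
      · have h1 := sub_eq_inner_cellGrad hK'.1 u (subset_hull (hK'.2 hf)) hy
        have h2 := affineMap_sub_eq_inner p f y
        rw [← hg, cellGrad_eq hK.1 u hp, ← h2, hp (subset_hull (hK.2 hf))] at h1
        linarith
  obtain ⟨p, hp⟩ := exists_affineMap_eqOn_of_locally_affine hΩ.isOpen hΩ.connected
    (u.2.1.mono subset_closure) T.finite_skeleton
    (fun A hA => by simpa using finrank_direction_skeleton hA) hloc
  exact ⟨p, hp.of_subset_closure u.2.1 p.continuous_of_finiteDimensional.continuousOn
    subset_closure subset_rfl⟩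

/-! ### Sides -/

/-- The hyperplane through `x` with normal `ν`. -/
def hyperplane (ν x : E d) : AffineSubspace ℝ (E d) := AffineSubspace.mk' x (ℝ ∙ ν)ᗮ

theorem mem_hyperplane {ν x y : E d} : y ∈ hyperplane ν x ↔ ⟪ν, y⟫_ℝ = ⟪ν, x⟫_ℝ := by
  rw [hyperplane, AffineSubspace.mem_mk', Submodule.mem_orthogonal_singleton_iff_inner_right,
    vsub_eq_sub, inner_sub_right, sub_eq_zero]

theorem direction_hyperplane (ν x : E d) : (hyperplane ν x).direction = (ℝ ∙ ν)ᗮ :=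
  AffineSubspace.direction_mk' _ _

theorem finrank_direction_hyperplane {ν : E d} (hν : ‖ν‖ = 1) (x : E d) :
    finrank ℝ (hyperplane ν x).direction = d - 1 := by
  rw [direction_hyperplane]
  have h0 : ν ≠ 0 := by rintro rfl; simp at hν
  have h1 := (ℝ ∙ ν).finrank_add_finrank_orthogonal
  rw [finrank_span_singleton h0, finrank_euclideanSpace_fin] at h1
  omega

theorem IsSide.exists_ball {S : Set (E d)} {ν : E d} (hS : IsSide Ω S ν) :
    ∃ x ∈ S, ∃ r > 0, (hyperplane ν x : Set (E d)) ∩ Metric.ball x r ⊆ S := by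
  obtain ⟨-, -, c, hc, x, hx, r, hr, h⟩ := hS
  exact ⟨x, hx, r, hr, fun y hy => h y hy.2 ((mem_hyperplane.1 hy.1).trans (hc x hx))⟩

/-- A nonzero value would persist on a relative ball of the hyperplane, which has positive measure.
-/
theorem eq_zero_on_of_ae_eq_zero {S : Set (E d)} (hSm : MeasurableSet S) {ν x : E d}
    (hν : ‖ν‖ = 1) {r : ℝ} (hS : (hyperplane ν x : Set (E d)) ∩ Metric.ball x r ⊆ S)
    {p : E d →ᵃ[ℝ] ℝ} (hp : ∀ᵐ y ∂(μHE[d - 1].restrict S), p y = 0) {y : E d}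
    (hy : y ∈ (hyperplane ν x : Set (E d)) ∩ Metric.ball x r) : p y = 0 := by
  by_contra hne
  obtain ⟨ε, hε, hball⟩ := Metric.mem_nhds_iff.1 (inter_mem (Metric.isOpen_ball.mem_nhds hy.2)
    (p.continuous_of_finiteDimensional.continuousAt.eventually_ne hne))
  have hsub : (hyperplane ν y : Set (E d)) ∩ Metric.ball y ε ⊆ {z | ¬ (z ∈ S → p z = 0)} := by
    rintro z ⟨hz, hzb⟩
    have hzH : z ∈ hyperplane ν x :=
      mem_hyperplane.2 ((mem_hyperplane.1 hz).trans (mem_hyperplane.1 hy.1))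
    exact fun h => (hball hzb).2 (h (hS ⟨hzH, (hball hzb).1⟩))
  refine (euclideanHausdorffMeasure_inter_ball_pos (mem_hyperplane.2 rfl) hε
    (finrank_direction_hyperplane hν y)).not_ge ((measure_mono hsub).trans ?_)
  exact (ae_iff.1 ((ae_restrict_iff' hSm).1 hp)).le

theorem affineGrad_eq_smul_of_eq_zero_on {ν x : E d} (hν : ‖ν‖ = 1) {r : ℝ} (hr : 0 < r)
    {p : E d →ᵃ[ℝ] ℝ} (hp : ∀ y ∈ (hyperplane ν x : Set (E d)) ∩ Metric.ball x r, p y = 0) :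
    affineGrad p = ⟪ν, affineGrad p⟫_ℝ • ν := by
  have hw : ∀ w, ⟪ν, w⟫_ℝ = 0 → ⟪affineGrad p, w⟫_ℝ = 0 := by
    intro w hw
    have hlim : Tendsto (fun t : ℝ => x + t • w) (𝓝[>] 0) (𝓝 x) := by
      have : Continuous fun t : ℝ => x + t • w := by fun_prop
      have := this.tendsto 0
      rw [zero_smul, add_zero] at this
      exact this.mono_left nhdsWithin_le_nhds
    obtain ⟨t, ht, ht0⟩ :=
      ((hlim.eventually (Metric.ball_mem_nhds x hr)).and self_mem_nhdsWithin).exists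
    have h1 : p (x + t • w) = 0 := hp _ ⟨mem_hyperplane.2 (by
      rw [inner_add_right, inner_smul_right, hw, mul_zero, add_zero]), ht⟩
    have h2 : p x = 0 := hp x ⟨mem_hyperplane.2 rfl, Metric.mem_ball_self hr⟩
    have h3 := affineMap_sub_eq_inner p x (x + t • w)
    rw [h1, h2, add_sub_cancel_left, inner_smul_right, sub_zero] at h3
    exact (mul_eq_zero.1 h3.symm).resolve_left (ne_of_gt ht0)
  -- The tangential part of the gradient is itself a vector orthogonal to `ν`; by `hw` it is
  -- orthogonal to the gradient, hence to itself.
  have hz : ⟪ν, affineGrad p - ⟪ν, affineGrad p⟫_ℝ • ν⟫_ℝ = 0 := by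
    rw [inner_sub_right, inner_smul_right, real_inner_self_eq_norm_sq, hν]
    ring
  have h := hw _ hz
  rw [← sub_eq_zero, ← inner_self_eq_zero (𝕜 := ℝ)]
  rw [inner_sub_left, h, inner_smul_left, hz]
  simp

/-- An affine function in the kernel of the Dirichlet conditions on a side vanishes somewhere on the
side, and its gradient is normal to the side. -/
theorem HasDirichletSide.exists_zero_and_affineGrad (hd : 0 < d) (hΩ : IsDomainSet Ω) (hμ : 0 < μ)
    {V : Submodule ℝ (E d → ℝ)} {ν : E d} (hside : HasDirichletSide V B ν) {u : T.P1}
    (huV : (u : E d → ℝ) ∈ V) (hu : dirichletPenalty T μ B u u = 0) {p : E d →ᵃ[ℝ] ℝ}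
    (hp : EqOn (u : E d → ℝ) p (closure Ω)) :
    (∃ x, p x = 0) ∧ affineGrad p = ⟪ν, affineGrad p⟫_ℝ • ν := by
  obtain ⟨S, hS, h⟩ := hside
  obtain ⟨x, hx, r, hr, hsub⟩ := hS.exists_ball
  have hzero : ∀ y ∈ (hyperplane ν x : Set (E d)) ∩ Metric.ball x r, p y = 0 := by
    rcases h with h | h
    · refine fun y hy => eq_zero_on_of_ae_eq_zero B.measurableSet_ΓD hS.2.1 (hsub.trans h) ?_ hy
      filter_upwards [ae_eq_zero_of_dirichletPenalty_self hd hΩ hμ hu,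
        ae_restrict_mem B.measurableSet_ΓD] with z hz hzD
      rw [← hp (frontier_subset_closure (B.ΓD_subset hzD)), hz]
    · intro y hy
      rw [← hp (frontier_subset_closure (hS.1 (hsub hy)))]
      exact h _ huV y (hsub hy)
  exact ⟨⟨x, hzero x ⟨mem_hyperplane.2 rfl, Metric.mem_ball_self hr⟩⟩,
    affineGrad_eq_smul_of_eq_zero_on hS.2.1 hr hzero⟩

/-- If the flats were not parallel, their intersection would have smaller dimension and be a null
set. -/
theorem direction_eq_of_measure_inter_pos {A H : AffineSubspace ℝ (E d)} {k : ℕ}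
    (hA : finrank ℝ A.direction = k) (hH : finrank ℝ H.direction = k)
    (hpos : 0 < μHE[k] ((A : Set (E d)) ∩ H)) : A.direction = H.direction := by
  have hle : k ≤ finrank ℝ (A ⊓ H).direction := by
    by_contra! hlt
    exact hpos.ne' (euclideanHausdorffMeasure_affineSubspace_eq_zero (A ⊓ H) hlt)
  have h1 : (A ⊓ H).direction = A.direction :=
    Submodule.eq_of_le_of_finrank_le (AffineSubspace.direction_le inf_le_left) (hA ▸ hle)
  have h2 : (A ⊓ H).direction = H.direction :=
    Submodule.eq_of_le_of_finrank_le (AffineSubspace.direction_le inf_le_right) (hH ▸ hle)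
  exact h1.symm.trans h2

/-- A side meets a parallel boundary facet in a set of positive measure. -/
theorem IsSide.exists_boundaryFacet (hd : 0 < d) (hΩ : IsDomainSet Ω) (T : Triangulation Ω)
    {S : Set (E d)} {ν : E d} (hS : IsSide Ω S ν) : ∃ F ∈ T.boundaryFacets,
      0 < μHE[d - 1] (hull F ∩ S) ∧
      (affineSpan ℝ (F : Set (E d))).direction = (ℝ ∙ ν)ᗮ := by
  obtain ⟨x, hx, r, hr, hsub⟩ := hS.exists_ball
  set U := (hyperplane ν x : Set (E d)) ∩ Metric.ball x r with hU
  have hHdim := finrank_direction_hyperplane hS.2.1 x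
  have hUpos : 0 < μHE[d - 1] U :=
    euclideanHausdorffMeasure_inter_ball_pos (mem_hyperplane.2 rfl) hr hHdim
  -- The skeleton is null and the boundary facets are finitely many, so one of them meets `U` in
  -- positive measure.
  have hcover : U ⊆ (⋃ A ∈ T.skeleton, (A : Set (E d))) ∪ ⋃ F ∈ T.boundaryFacets, hull F ∩ U := by
    intro y hy
    by_cases hys : y ∈ ⋃ A ∈ T.skeleton, (A : Set (E d))
    · exact Or.inl hys
    · obtain ⟨F, hF, hyF⟩ := T.exists_boundaryFacet_of_mem_frontier hd hΩ (hS.1 (hsub hy))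
        (by simpa using hys)
      exact Or.inr (mem_biUnion hF ⟨hyF, hy⟩)
  obtain ⟨F, hF, hFU⟩ : ∃ F ∈ T.boundaryFacets, 0 < μHE[d - 1] (hull F ∩ U) := by
    by_contra! hnone
    refine hUpos.not_ge ((measure_mono hcover).trans ((measure_union_le _ _).trans ?_))
    rw [T.measure_skeleton_eq_zero hd, zero_add]
    exact (measure_biUnion_finset_le _ _).trans (Finset.sum_nonpos hnone)
  refine ⟨F, hF, hFU.trans_le (measure_mono (inter_subset_inter_right _ hsub)), ?_⟩
  rw [← direction_hyperplane ν x]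
  refine direction_eq_of_measure_inter_pos
    (finrank_direction_of_facet (Finset.mem_filter.1 hF).1) hHdim (hFU.trans_le (measure_mono ?_))
  exact inter_subset_inter (hull_subset_affineSpan F) inter_subset_left

/-- The orientation of `ν` is not prescribed, so only a nonzero multiple can be asserted; this
suffices for orthogonality. -/
theorem IsOuterNormal.exists_smul {K F : Finset (E d)} {n ν : E d} (hn : IsOuterNormal K F n)
    (hF : (affineSpan ℝ (F : Set (E d))).direction = (ℝ ∙ ν)ᗮ) :
    ∃ t : ℝ, t ≠ 0 ∧ n = t • ν := by
  have hmem : n ∈ (ℝ ∙ ν)ᗮᗮ := by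
    rw [← hF, direction_affineSpan, vectorSpan_def, Submodule.mem_orthogonal']
    intro w hw
    refine Submodule.span_induction (p := fun w _ => ⟪n, w⟫_ℝ = 0) ?_ (inner_zero_right _)
      (fun a b _ _ ha hb => by rw [inner_add_right, ha, hb, add_zero])
      (fun c a _ ha => by rw [inner_smul_right, ha, mul_zero]) hw
    rintro _ ⟨y, hy, x, hx, rfl⟩
    exact hn.2.1 x hx y hy
  rw [Submodule.orthogonal_orthogonal] at hmem
  obtain ⟨t, rfl⟩ := Submodule.mem_span_singleton.1 hmem
  refine ⟨t, ?_, rfl⟩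
  rintro rfl
  simpa using hn.1

/-- A side need not be a union of facets. One parallel facet that overlaps it in positive measure is
enough, since the gradient is the same everywhere. -/
theorem HasNeumannSide.inner_affineGrad_eq_zero (hd : 0 < d) (hΩ : IsDomainSet Ω) {ν : E d}
    (hside : HasNeumannSide B ν) {u : T.P1} (hu : neumannPenalty T B u u = 0) {p : E d →ᵃ[ℝ] ℝ}
    (hp : EqOn (u : E d → ℝ) p (closure Ω)) : ⟪affineGrad p, ν⟫_ℝ = 0 := by
  obtain ⟨S, hS, hSN⟩ := hside
  obtain ⟨F, hF, hpos, hdir⟩ := hS.exists_boundaryFacet hd hΩ T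
  obtain ⟨hFf, hFc⟩ := Finset.mem_filter.1 hF
  obtain ⟨K, hK⟩ := Finset.card_pos.1 (by rw [hFc]; exact one_pos)
  have hKc := (T.mem_cellsAt.1 hK).1
  have h := inner_outerNormal_eq_zero_of_neumannPenalty_self hd hΩ hu hF hK
    (hpos.trans_le (measure_mono (inter_subset_inter_right _ hSN)))
  obtain ⟨t, ht, hn⟩ := (isOuterNormal_outerNormal hd (T.mem_facets.1 hFf).2 hK).exists_smul hdir
  rw [cellGrad_eq hKc u (hp.mono (hull_subset_closure hKc)), hn, inner_smul_right] at h
  exact (mul_eq_zero.1 h).resolve_left ht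

/-! ### Kernel of the stabilisation under the boundary conditions -/

theorem eq_zero_of_affineGrad_eq_zero {u : T.P1} {p : E d →ᵃ[ℝ] ℝ}
    (hp : EqOn (u : E d → ℝ) p (closure Ω)) (hg : affineGrad p = 0) (hx : ∃ x, p x = 0) : u = 0 := by
  obtain ⟨x, hx⟩ := hx
  ext y
  by_cases hy : y ∈ closure Ω
  · have := affineMap_sub_eq_inner p x y
    rw [hx, hg, inner_zero_left, sub_zero] at this
    rw [hp hy, this]
    rfl
  · exact u.2.2.1 y hy

/-- The gradient is a multiple of two independent normals, hence zero, and the function has a zero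
on a side. -/
theorem TwoDirichletSides.eq_zero {V : Submodule ℝ (E d → ℝ)} (h : TwoDirichletSides V B)
    (hd : 1 < d) (hΩ : IsDomainSet Ω) (hμ : 0 < μ) (hγ₁ : ∀ F ∈ T.interiorFacets, 0 < γ₁ F)
    {u : T.P1} (huV : (u : E d → ℝ) ∈ V) (hu : stab T γ₁ γ₂ μ B u u = 0) : u = 0 := by
  obtain ⟨hc, hD, -⟩ := parts_eq_zero_of_stab_self hγ₁ hμ hu
  obtain ⟨p, hp⟩ := exists_affineMap_of_scip_self_eq_zero hd hΩ hγ₁ hc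
  obtain ⟨ν₁, ν₂, h₁, h₂, hli⟩ := h
  obtain ⟨hx, hg₁⟩ := h₁.exists_zero_and_affineGrad (by omega) hΩ hμ huV hD hp
  obtain ⟨-, hg₂⟩ := h₂.exists_zero_and_affineGrad (by omega) hΩ hμ huV hD hp
  refine eq_zero_of_affineGrad_eq_zero hp ?_ hx
  have h0 := (LinearIndependent.pair_iff.1 hli ⟪ν₁, affineGrad p⟫_ℝ (-⟪ν₂, affineGrad p⟫_ℝ)
    (by rw [neg_smul, ← hg₁, ← hg₂, add_neg_cancel])).1
  rw [hg₁, h0, zero_smul]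

/-- The gradient is a multiple of `ν₁` and orthogonal to `ν₂`, which is not orthogonal to `ν₁`. -/
theorem DirichletNeumannSides.eq_zero {V : Submodule ℝ (E d → ℝ)} (h : DirichletNeumannSides V B)
    (hd : 1 < d) (hΩ : IsDomainSet Ω) (hμ : 0 < μ) (hγ₁ : ∀ F ∈ T.interiorFacets, 0 < γ₁ F)
    {u : T.P1} (huV : (u : E d → ℝ) ∈ V) (hu : stab T γ₁ γ₂ μ B u u = 0) : u = 0 := by
  obtain ⟨hc, hD, hN⟩ := parts_eq_zero_of_stab_self hγ₁ hμ hu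
  obtain ⟨p, hp⟩ := exists_affineMap_of_scip_self_eq_zero hd hΩ hγ₁ hc
  obtain ⟨ν₁, ν₂, h₁, h₂, hne⟩ := h
  obtain ⟨hx, hg⟩ := h₁.exists_zero_and_affineGrad (by omega) hΩ hμ huV hD hp
  refine eq_zero_of_affineGrad_eq_zero hp ?_ hx
  have h0 := h₂.inner_affineGrad_eq_zero (by omega) hΩ hN hp
  rw [hg, real_inner_smul_left] at h0
  rw [hg, (mul_eq_zero.1 h0).resolve_right hne, zero_smul]

theorem IndependentNeumannSides.exists_eq_smul_one (h : IndependentNeumannSides B)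
    (hd : 1 < d) (hΩ : IsDomainSet Ω) (hμ : 0 < μ) (hγ₁ : ∀ F ∈ T.interiorFacets, 0 < γ₁ F)
    {u : T.P1} (hu : stab T γ₁ γ₂ μ B u u = 0) : ∃ c : ℝ, (u : E d → ℝ) = c • one Ω := by
  obtain ⟨hc, -, hN⟩ := parts_eq_zero_of_stab_self hγ₁ hμ hu
  obtain ⟨p, hp⟩ := exists_affineMap_of_scip_self_eq_zero hd hΩ hγ₁ hc
  obtain ⟨ν, hν, hli⟩ := h
  have hspan : Submodule.span ℝ (range ν) = ⊤ := hli.span_eq_top_of_card_eq_finrank' (by simp)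
  have hg : affineGrad p = 0 := by
    have hmem : affineGrad p ∈ (Submodule.span ℝ (range ν))ᗮ := by
      rw [Submodule.mem_orthogonal']
      intro w hw
      refine Submodule.span_induction (p := fun w _ => ⟪affineGrad p, w⟫_ℝ = 0) ?_
        (inner_zero_right _) (fun a b _ _ ha hb => by rw [inner_add_right, ha, hb, add_zero])
        (fun c a _ ha => by rw [inner_smul_right, ha, mul_zero]) hw
      rintro _ ⟨i, rfl⟩
      exact (hν i).inner_affineGrad_eq_zero (by omega) hΩ hN hp
    rwa [hspan, Submodule.top_orthogonal_eq_bot, Submodule.mem_bot] at hmem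
  -- The origin need not lie in the closure of `Ω`; `p` is constant on the whole space.
  refine ⟨p 0, ?_⟩
  ext y
  by_cases hy : y ∈ closure Ω
  · have := affineMap_sub_eq_inner p 0 y
    rw [hg, inner_zero_left, sub_eq_zero] at this
    simp [one, hy, hp hy, this]
  · simp [one, hy, u.2.2.1 y hy]

/-! ### Finite dimension -/

theorem eq_zero_of_eq_zero_on_cells {u : T.P1}
    (h : ∀ K ∈ T.cells, ∀ a ∈ K, (u : E d → ℝ) a = 0) : u = 0 := by
  ext y
  by_cases hy : y ∈ closure Ω
  · obtain ⟨K, hK, hyK⟩ := T.exists_cell hy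
    obtain ⟨p, hp⟩ := u.2.2.2 K hK
    have : p = 0 := (isBary hK).affineMap_ext fun a ha => by
      rw [← hp (subset_hull ha), h K hK a ha]; rfl
    rw [hp hyK, this]
    rfl
  · exact u.2.2.1 y hy

theorem finiteDimensional_P1 (T : Triangulation Ω) : FiniteDimensional ℝ T.P1 := by
  classical
  let ev : T.P1 →ₗ[ℝ] (T.cells.biUnion id → ℝ) :=
    { toFun := fun u a => (u : E d → ℝ) a
      map_add' := fun _ _ => rfl
      map_smul' := fun _ _ => rfl }
  refine FiniteDimensional.of_injective ev ((injective_iff_map_eq_zero ev).2 fun u hu => ?_)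
  exact eq_zero_of_eq_zero_on_cells fun K hK a ha =>
    congrFun hu ⟨a, Finset.mem_biUnion.2 ⟨K, hK, ha⟩⟩

/-- This makes evaluation at the `d + 1` vertices of one cell injective on the kernel, which yields
the dimension bound. -/
theorem eq_zero_of_scip_of_eq_zero_on_cell (hd : 1 < d) (hΩ : IsDomainSet Ω)
    (hγ₁ : ∀ F ∈ T.interiorFacets, 0 < γ₁ F) {u : T.P1} (hu : scip T γ₁ γ₂ u u = 0)
    {K : Finset (E d)} (hK : K ∈ T.cells) (h : ∀ a ∈ K, (u : E d → ℝ) a = 0) : u = 0 := by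
  obtain ⟨p, hp⟩ := exists_affineMap_of_scip_self_eq_zero hd hΩ hγ₁ hu
  have h0 : p = 0 := (isBary hK).affineMap_ext fun a ha => by
    rw [← hp (hull_subset_closure hK (subset_hull ha)), h a ha]; rfl
  ext y
  by_cases hy : y ∈ closure Ω
  · rw [hp hy, h0]; rfl
  · exact u.2.2.1 y hy

/-! ### Stabilised saddle point systems -/

theorem stab_comm (u v : T.P1) : stab T γ₁ γ₂ μ B u v = stab T γ₁ γ₂ μ B v u := by
  have h1 : scip T γ₁ γ₂ u v = scip T γ₁ γ₂ v u := by
    rw [scip_eq_sum, scip_eq_sum]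
    simp_rw [real_inner_comm]
  have h2 : dirichletPenalty T μ B u v = dirichletPenalty T μ B v u := by
    simp only [dirichletPenalty, mul_comm ((u : E d → ℝ) _)]
  have h3 : neumannPenalty T B u v = neumannPenalty T B v u := by
    simp only [neumannPenalty_eq_sum, mul_comm ⟪T.cellGrad _ u, _⟫_ℝ]
  rw [stab, stab, h1, h2, h3]

section Saddle

variable {V : Type*} [AddCommGroup V] [Module ℝ V]

/-- The operator `(u, z) ↦ (a(u, ·) + s_a(z, ·), a(·, z) - s_p(u, ·))`. -/
def saddle (a sp sa : V →ₗ[ℝ] V →ₗ[ℝ] ℝ) : V × V →ₗ[ℝ] (V →ₗ[ℝ] ℝ) × (V →ₗ[ℝ] ℝ) :=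
  (a.coprod sa).prod ((-sp).coprod a.flip)

variable {a sp sa : V →ₗ[ℝ] V →ₗ[ℝ] ℝ}

theorem saddle_eq_iff {ℓ₁ ℓ₂ : V →ₗ[ℝ] ℝ} {p : V × V} : saddle a sp sa p = (ℓ₁, ℓ₂) ↔
    (∀ w, a p.1 w + sa p.2 w = ℓ₁ w) ∧ ∀ v, a v p.2 - sp p.1 v = ℓ₂ v := by
  simp [saddle, LinearMap.ext_iff, sub_eq_neg_add]

/-- Testing each equation with the other's unknown produces the same term `a(u, z)` twice;
subtraction removes it. -/
theorem self_eq_zero_of_saddle_eq_zero (hsp : ∀ u, 0 ≤ sp u u) (hsa : ∀ u, 0 ≤ sa u u) {p : V × V}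
    (hp : saddle a sp sa p = 0) : sp p.1 p.1 = 0 ∧ sa p.2 p.2 = 0 := by
  obtain ⟨h1, h2⟩ := saddle_eq_iff.1 hp
  have h1 := h1 p.2
  have h2 := h2 p.1
  simp only [LinearMap.zero_apply] at h1 h2
  constructor <;> linarith [hsp p.1, hsa p.2]

/-- Cauchy–Schwarz for semidefinite forms: `s(u, v)² ≤ s(u, u) s(v, v)`. -/
theorem apply_eq_zero_of_self_eq_zero {s : V →ₗ[ℝ] V →ₗ[ℝ] ℝ} (hs : ∀ u, 0 ≤ s u u)
    (hsymm : ∀ u v, s u v = s v u) {u : V} (hu : s u u = 0) (v : V) : s u v = 0 := by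
  have h := LinearMap.BilinForm.apply_sq_le_of_symm s hs ⟨hsymm⟩ u v
  rw [hu, zero_mul] at h
  exact pow_eq_zero_iff two_ne_zero |>.1 (le_antisymm h (sq_nonneg _))

theorem existsUnique_saddle_eq [FiniteDimensional ℝ V] (h : ∀ p, saddle a sp sa p = 0 → p = 0)
    (ℓ : (V →ₗ[ℝ] ℝ) × (V →ₗ[ℝ] ℝ)) : ∃! p, saddle a sp sa p = ℓ := by
  have hinj : Function.Injective (saddle a sp sa) := (injective_iff_map_eq_zero _).2 h
  have hsurj : Function.Surjective (saddle a sp sa) :=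
    (LinearMap.injective_iff_surjective_of_finrank_eq_finrank
      (by rw [finrank_prod, finrank_prod, ← Subspace.dual_finrank_eq (K := ℝ) (V := V)])).1 hinj
  exact (Function.bijective_iff_existsUnique _).1 ⟨hinj, hsurj⟩ ℓ

end Saddle

end CIP

end

/-! ### The kernel bound and unique solvability -/

theorem mainTheorem3 (d : ℕ) (hd : d = 2 ∨ d = 3)
    (Ω : Set (CIP.E d)) (hΩ : CIP.IsDomainSet Ω) (T : CIP.Triangulation Ω)
    (V : Submodule ℝ (CIP.E d → ℝ)) (hV : V ≤ T.P1)
    (ah : V →ₗ[ℝ] V →ₗ[ℝ] ℝ)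
    (γ₁ γ₂ : Finset (CIP.E d) → ℝ) (hγ₁ : ∀ F ∈ T.interiorFacets, 0 < γ₁ F)
    (hγ₂ : ∀ F ∈ T.interiorFacets, 0 ≤ γ₂ F)
    (μ : ℝ) (hμ : 0 < μ) (Bp Ba : CIP.WeakBC Ω) :
    (∃ N : Submodule ℝ (V × V),
      (∀ p : V × V, p ∈ N ↔
        CIP.SolvesFEM ah (CIP.stab T γ₁ γ₂ μ Bp) (CIP.stab T γ₁ γ₂ μ Ba) 0 0 p) ∧
      Module.rank ℝ N ≤ (2 * (d + 1) : ℕ)) ∧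
    ((CIP.TwoDirichletSides V Bp ∧ CIP.TwoDirichletSides V Ba) ∨
      (CIP.DirichletNeumannSides V Bp ∧ CIP.DirichletNeumannSides V Ba) ∨
      (CIP.IndependentNeumannSides Bp ∧ CIP.IndependentNeumannSides Ba ∧
        CIP.ConstantsCondition Ω ah) →
      ∀ ℓ₁ ℓ₂ : V →ₗ[ℝ] ℝ, ∃! p : V × V,
        CIP.SolvesFEM ah (CIP.stab T γ₁ γ₂ μ Bp) (CIP.stab T γ₁ γ₂ μ Ba) ℓ₁ ℓ₂ p) := by
  have hd1 : 1 < d := by omega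
  have hfin := CIP.finiteDimensional_P1 T
  let ι : V →ₗ[ℝ] T.P1 := Submodule.inclusion hV
  have hι : ∀ v : V, ι v = 0 → v = 0 := fun v hv =>
    (injective_iff_map_eq_zero ι).1 (Submodule.inclusion_injective hV) v hv
  have hVfin : FiniteDimensional ℝ V :=
    FiniteDimensional.of_injective ι (Submodule.inclusion_injective hV)
  obtain ⟨Sp, hSp⟩ := CIP.exists_stabForm (by omega) hΩ T γ₁ γ₂ μ Bp
  obtain ⟨Sa, hSa⟩ := CIP.exists_stabForm (by omega) hΩ T γ₁ γ₂ μ Ba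
  have hp : ∀ u v : V, Sp.compl₁₂ ι ι u v = CIP.stab T γ₁ γ₂ μ Bp u v := fun u v =>
    hSp (ι u) (ι v)
  have ha : ∀ u v : V, Sa.compl₁₂ ι ι u v = CIP.stab T γ₁ γ₂ μ Ba u v := fun u v =>
    hSa (ι u) (ι v)
  have hsolve : ∀ ℓ₁ ℓ₂ p,
      CIP.SolvesFEM ah (CIP.stab T γ₁ γ₂ μ Bp) (CIP.stab T γ₁ γ₂ μ Ba) ℓ₁ ℓ₂ p ↔
        CIP.saddle ah (Sp.compl₁₂ ι ι) (Sa.compl₁₂ ι ι) p = (ℓ₁, ℓ₂) := fun ℓ₁ ℓ₂ p => by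
    simp only [CIP.saddle_eq_iff, CIP.SolvesFEM, hp, ha]
  have hker : ∀ p, CIP.saddle ah (Sp.compl₁₂ ι ι) (Sa.compl₁₂ ι ι) p = 0 →
      CIP.stab T γ₁ γ₂ μ Bp (ι p.1) (ι p.1) = 0 ∧ CIP.stab T γ₁ γ₂ μ Ba (ι p.2) (ι p.2) = 0 := by
    intro p h0
    obtain ⟨h1, h2⟩ := CIP.self_eq_zero_of_saddle_eq_zero
      (fun u => by rw [hp]; exact CIP.stab_self_nonneg hγ₁ hμ (ι u))
      (fun u => by rw [ha]; exact CIP.stab_self_nonneg hγ₁ hμ (ι u)) h0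
    rw [hp] at h1
    rw [ha] at h2
    exact ⟨h1, h2⟩
  refine ⟨⟨LinearMap.ker (CIP.saddle ah (Sp.compl₁₂ ι ι) (Sa.compl₁₂ ι ι)), fun p => ?_, ?_⟩, ?_⟩
  · rw [LinearMap.mem_ker, hsolve]
    rfl
  · obtain ⟨K, hK⟩ := T.cells_nonempty hΩ
    -- Vertex values of `u` and of `z` on one cell: two copies of `d + 1` numbers determine a kernel
    -- element.
    let ev : V →ₗ[ℝ] (K → ℝ) :=
      { toFun := fun u a => (u : CIP.E d → ℝ) a
        map_add' := fun _ _ => rfl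
        map_smul' := fun _ _ => rfl }
    have hinj : Function.Injective ((ev.prodMap ev).domRestrict
        (LinearMap.ker (CIP.saddle ah (Sp.compl₁₂ ι ι) (Sa.compl₁₂ ι ι)))) := by
      refine (injective_iff_map_eq_zero _).2 fun p h0 => ?_
      obtain ⟨h1, h2⟩ := hker p p.2
      have hz := Prod.ext_iff.1 h0
      have e1 := hι _ (CIP.eq_zero_of_scip_of_eq_zero_on_cell hd1 hΩ hγ₁
        (CIP.parts_eq_zero_of_stab_self hγ₁ hμ h1).1 hK fun a haK => congrFun hz.1 ⟨a, haK⟩)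
      have e2 := hι _ (CIP.eq_zero_of_scip_of_eq_zero_on_cell hd1 hΩ hγ₁
        (CIP.parts_eq_zero_of_stab_self hγ₁ hμ h2).1 hK fun a haK => congrFun hz.2 ⟨a, haK⟩)
      exact Subtype.ext (Prod.ext e1 e2)
    have hle := LinearMap.finrank_le_finrank_of_injective hinj
    rw [Module.finrank_prod, Module.finrank_fintype_fun_eq_card, Fintype.card_coe,
      (T.mem_cells.1 hK).2] at hle
    rw [← Module.finrank_eq_rank]
    exact_mod_cast hle.trans (by omega)
  · intro hcond ℓ₁ ℓ₂
    simp_rw [hsolve]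
    refine CIP.existsUnique_saddle_eq (fun p h0 => ?_) _
    obtain ⟨h1, h2⟩ := hker p h0
    rcases hcond with ⟨cp, ca⟩ | ⟨cp, ca⟩ | ⟨cp, ca, hc⟩
    · exact Prod.ext (hι _ (cp.eq_zero hd1 hΩ hμ hγ₁ p.1.2 h1))
        (hι _ (ca.eq_zero hd1 hΩ hμ hγ₁ p.2.2 h2))
    · exact Prod.ext (hι _ (cp.eq_zero hd1 hΩ hμ hγ₁ p.1.2 h1))
        (hι _ (ca.eq_zero hd1 hΩ hμ hγ₁ p.2.2 h2))
    · obtain ⟨c₁, hc₁⟩ := cp.exists_eq_smul_one hd1 hΩ hμ hγ₁ h1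
      obtain ⟨c₂, hc₂⟩ := ca.exists_eq_smul_one hd1 hΩ hμ hγ₁ h2
      have hc₁ : (p.1 : CIP.E d → ℝ) = c₁ • CIP.one Ω := hc₁
      have hc₂ : (p.2 : CIP.E d → ℝ) = c₂ • CIP.one Ω := hc₂
      suffices H : c₁ = 0 ∧ c₂ = 0 from Prod.ext
        (Subtype.ext (by rw [hc₁, H.1, zero_smul]; rfl))
        (Subtype.ext (by rw [hc₂, H.2, zero_smul]; rfl))
      rcases hc with h1V | ⟨h1V, v, w, hv, hw⟩
      · have key : ∀ (c : ℝ) (u : V), (u : CIP.E d → ℝ) = c • CIP.one Ω → c = 0 := by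
          intro c u hu
          by_contra hne
          refine h1V ?_
          rw [← inv_smul_smul₀ hne (CIP.one Ω), ← hu]
          exact V.smul_mem _ u.2
        exact ⟨key c₁ _ hc₁, key c₂ _ hc₂⟩
      · obtain ⟨e1, e2⟩ := CIP.saddle_eq_iff.1 h0
        have hp1 : p.1 = c₁ • ⟨CIP.one Ω, h1V⟩ := Subtype.ext hc₁
        have hp2 : p.2 = c₂ • ⟨CIP.one Ω, h1V⟩ := Subtype.ext hc₂
        have e1 := e1 v
        have e2 := e2 w
        -- With both stabilisation terms gone, the equations tested with `v` and `w` read `c₁ a_h(1,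
        -- v) = 0` and `c₂ a_h(w, 1) = 0`.
        have s1 : Sa.compl₁₂ ι ι p.2 v = 0 := CIP.apply_eq_zero_of_self_eq_zero
          (fun u => by rw [ha]; exact CIP.stab_self_nonneg hγ₁ hμ (ι u))
          (fun u u' => by rw [ha, ha]; exact CIP.stab_comm (ι u) (ι u')) ((ha _ _).trans h2) v
        have s2 : Sp.compl₁₂ ι ι p.1 w = 0 := CIP.apply_eq_zero_of_self_eq_zero
          (fun u => by rw [hp]; exact CIP.stab_self_nonneg hγ₁ hμ (ι u))
          (fun u u' => by rw [hp, hp]; exact CIP.stab_comm (ι u) (ι u')) ((hp _ _).trans h1) w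
        rw [s1, hp1, add_zero, map_smul, LinearMap.smul_apply, smul_eq_mul] at e1
        rw [s2, hp2, sub_zero, map_smul, smul_eq_mul] at e2
        exact ⟨(mul_eq_zero.1 e1).resolve_right hv, (mul_eq_zero.1 e2).resolve_right hw⟩
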